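/- Let $d\in\{2,3\}$ and let $\Omega\subset\mathbb R^d$ be a bounded open set with Lipschitz boundary, with outer unit normal $\mathbf n$ (defined almost everywhere on $\partial\Omega$) and surface measure $dS$. The whole boundary is a fixed solid wall, $\partial\Omega_w=\partial\Omega$. Parameters: let $Re,\beta,\epsilon,\rho_1,\rho_2,\eta_1,\eta_2,l_{s1},l_{s2}>0$ and $\alpha_w,\theta_s\in\mathbb R$; put $\alpha=\frac{\rho_2-\rho_1}{\rho_1\rho_2}$. The bulk mobility $M=M(c)$ is a smooth function of $c$ (possibly constant) and the wall mobility $M_\Gamma=M_\Gamma(c)$ is a function of $c$ (possibly constant). Put $$\frac1{\rho(c)}=\frac c{\rho_1}+\frac{1-c}{\rho_2},\quad \frac1{\eta(c)}=\frac c{\eta_1}+\frac{1-c}{\eta_2},\quad l_s(c)=c\,l_{s1}+(1-c)\,l_{s2},$$ $$G(c)=\tfrac14c^2(1-c)^2,\qquad f_w(c)=-\tfrac12\cos(\theta_s)\sin\!\Big(\frac{(2c-1)\pi}2\Big).$$ Let $(c,\bar\mu,\mathbf u,\bar p)$ be smooth up to the boundary, i.e. on $I\times\overline\Omega$ for an open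 set $I$ of times, such that $\rho(c),\eta(c)$ are well defined and positive on $\overline\Omega$ and $l_s(c)>0$ on $\partial\Omega$. Suppose that in $I\times\Omega$, with $\frac{D}{Dt}=\partial_t+\mathbf u\cdot\nabla$, $\rho=\rho(c)$ and $\eta=\eta(c)$, $$\rho\frac{Dc}{Dt}=\nabla\cdot(M\nabla\bar\mu)+\alpha\nabla\cdot(M\nabla\bar p),$$ $$\bar\mu=\frac1\epsilon G'(c)-\frac\epsilon\rho\nabla\cdot(\rho\nabla c)-\alpha\rho\Big(\frac1\epsilon G(c)+\frac\epsilon2|\nabla c|^2\Big),$$ $$Re\,\rho\frac{D\mathbf u}{Dt}=\nabla\cdot\big(\eta(\nabla\mathbf u+(\nabla\mathbf u)^T)\big)-\nabla\Big(\frac{2\eta}3\nabla\cdot\mathbf u\Big)-\frac{Re}\beta\nabla\bar p+\frac{Re}\beta\rho\bar\mu\nabla c,$$ $$\nabla\cdot\mathbf u=\alpha\nabla\cdot(M\nabla\bar\mu)+\alpha^2\nabla\cdot(M\nabla\bar p).$$ Put $\tilde\mu=\bar\mu+\alpha\bar p$, $p=\bar p-\rho\big(\frac1\epsilon G(c)+\frac\epsilon2|\nabla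 c|^2\big)$, $\boldsymbol\sigma_\eta=\eta(\nabla\mathbf u+(\nabla\mathbf u)^T)-\frac{2\eta}3(\nabla\cdot\mathbf u)I-\frac{Re}\beta pI$, and, on $\partial\Omega$, $\nabla_\Gamma=\nabla-\mathbf n(\mathbf n\cdot\nabla)$, $\mathbf u^s=\mathbf u-(\mathbf u\cdot\mathbf n)\mathbf n$ and $L(c)=\epsilon\rho\,\partial_nc+\alpha_wf_w'(c)$. Suppose that on $\partial\Omega$, wherever the normal exists, $$\partial_tc+\mathbf u\cdot\nabla_\Gamma c=-M_\Gamma L(c),\qquad \partial_n\tilde\mu=0,\qquad \mathbf u\cdot\mathbf n=0,$$ $$l_s^{-1}\,\mathbf u^s\cdot\boldsymbol\tau=-\mathbf n\cdot\boldsymbol\sigma_\eta\cdot\boldsymbol\tau+\frac{Re}\beta L(c)\,\partial_{\boldsymbol\tau}c\quad\text{for every }\boldsymbol\tau\perp\mathbf n .$$ Then, for every $t\in I$, the total energy is differentiable at $t$ and $$\begin{aligned} \frac{d}{dt}&\left\{\int_\Omega\frac{\rho|\mathbf u|^2}2\,d\mathbf x+\frac1\beta\int_\Omega\rho\Big(\frac1\epsilon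 G(c)+\frac\epsilon2|\nabla c|^2\Big)d\mathbf x+\frac{\alpha_w}\beta\int_{\partial\Omega}f_w(c)\,dS\right\}\\ ={}&-\frac1{Re}\int_\Omega\eta\sum_{1\le i<j\le3}|\partial_iu_j+\partial_ju_i|^2d\mathbf x-\frac2{3Re}\int_\Omega\eta\sum_{1\le i<j\le3}|\partial_iu_i-\partial_ju_j|^2d\mathbf x-\frac1\beta\int_\Omega M|\nabla\tilde\mu|^2d\mathbf x\\ &-\int_{\partial\Omega}\Big(\frac1\beta M_\Gamma|L(c)|^2+\frac1{l_sRe}|\mathbf u^s|^2\Big)dS . \end{aligned}$$ If $d=2$, the sums are those of the planar flow in three-dimensional space: $u_3=0$ and $\partial_3=0$. -/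

import Mathlib

open MeasureTheory Set Filter Topology
open scoped ContDiff

noncomputable section

/-! ### Geometry of the flow domain -/

/-- The physical space `ℝ^d` with its Euclidean norm. -/
abbrev Space (d : ℕ) : Type := EuclideanSpace ℝ (Fin d)

/-- `Ω` has a Lipschitz boundary: near each boundary point, in suitable orthogonal coordinates
(the height in the direction of a unit vector `e`, and the projection orthogonal to `e`), the set
`Ω` is the region strictly below the graph of a Lipschitz function. Only the values of `φ` on the
hyperplane orthogonal to `e` matter. -/
def HasLipschitzBoundary {d : ℕ} (Ω : Set (Space d)) : Prop :=
  ∀ x₀ ∈ frontier Ω, ∃ (e : Space d) (φ : Space d → ℝ) (K : NNReal) (r : ℝ),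
    ‖e‖ = 1 ∧ LipschitzWith K φ ∧ 0 < r ∧
      ∀ y ∈ Metric.ball x₀ r, y ∈ Ω ↔ inner ℝ e y < φ (y - (inner ℝ e y : ℝ) • e)

/-- `n` is the outer unit normal to `Ω` at `x`: to first order at `x`, the set `Ω` is the
half-space `{y | ⟪n, y - x⟫ < 0}`. -/
def IsOuterUnitNormal {d : ℕ} (Ω : Set (Space d)) (x n : Space d) : Prop :=
  ‖n‖ = 1 ∧ ∀ δ > (0 : ℝ), ∃ r > (0 : ℝ), ∀ y ∈ Metric.ball x r,
    (inner ℝ n (y - x) < -(δ * ‖y - x‖) → y ∈ Ω) ∧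
    (δ * ‖y - x‖ < inner ℝ n (y - x) → y ∉ Ω)

/-- The outer unit normal is unique where it exists. -/
theorem IsOuterUnitNormal.unique {d : ℕ} {Ω : Set (Space d)} {x n m : Space d}
    (hn : IsOuterUnitNormal Ω x n) (hm : IsOuterUnitNormal Ω x m) : n = m := by
  by_contra hne
  have h1 : inner ℝ n m < 1 := by
    have := (inner_lt_one_iff_real_of_norm_eq_one hn.1 hm.1).2 hne
    exact this
  set v : Space d := m - n with hv
  have hv0 : 0 < ‖v‖ := norm_pos_iff.2 (sub_ne_zero.2 (Ne.symm hne))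
  set a : ℝ := 1 - inner ℝ n m with ha
  have ha0 : 0 < a := by linarith
  have hnv : inner ℝ n v = -a := by
    rw [hv, inner_sub_right, real_inner_self_eq_norm_sq, hn.1]; ring
  have hmv : inner ℝ m v = a := by
    rw [hv, inner_sub_right, real_inner_self_eq_norm_sq, hm.1, real_inner_comm]; ring
  set δ : ℝ := a / (2 * ‖v‖) with hδ
  have hδ0 : 0 < δ := by positivity
  have hδv : δ * ‖v‖ = a / 2 := by rw [hδ]; field_simp
  obtain ⟨r, hr, h⟩ := hn.2 δ hδ0
  obtain ⟨r', hr', h'⟩ := hm.2 δ hδ0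
  set s : ℝ := min r r' / (2 * ‖v‖) with hs
  have hs0 : 0 < s := by have := lt_min hr hr'; positivity
  have hsv : s * ‖v‖ = min r r' / 2 := by rw [hs]; field_simp
  have hmin := lt_min hr hr'
  have hnorm : ‖(x + s • v) - x‖ = s * ‖v‖ := by
    rw [add_sub_cancel_left, norm_smul, Real.norm_of_nonneg hs0.le]
  have hin : x + s • v ∈ Ω := by
    refine (h _ ?_).1 ?_
    · rw [mem_ball_iff_norm, hnorm, hsv]
      linarith [min_le_left r r']
    · rw [hnorm, add_sub_cancel_left, inner_smul_right, hnv]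
      nlinarith
  refine (h' (x + s • v) ?_).2 ?_ hin
  · rw [mem_ball_iff_norm, hnorm, hsv]
    linarith [min_le_right r r']
  · rw [hnorm, add_sub_cancel_left, inner_smul_right, hmv]
    nlinarith

open Classical in
/-- The outer unit normal field of `Ω` (set to `0` at points without a normal). -/
def outerNormal {d : ℕ} (Ω : Set (Space d)) (x : Space d) : Space d :=
  if h : ∃ n, IsOuterUnitNormal Ω x n then h.choose else 0

theorem IsOuterUnitNormal.outerNormal_eq {d : ℕ} {Ω : Set (Space d)} {x n : Space d}
    (h : IsOuterUnitNormal Ω x n) : outerNormal Ω x = n := by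
  have hex : ∃ n, IsOuterUnitNormal Ω x n := ⟨n, h⟩
  rw [outerNormal, dif_pos hex]
  exact hex.choose_spec.unique h

/-- Surface measure `dS` on `∂Ω`: the `(d-1)`-dimensional Hausdorff measure, normalised so as to
agree with Lebesgue measure on hyperplanes, restricted to `∂Ω`. -/
def surfaceMeasure {d : ℕ} (Ω : Set (Space d)) : Measure (Space d) :=
  (Measure.euclideanHausdorffMeasure (d - 1)).restrict (frontier Ω)

/-! ### Differential operators -/

/-- The partial derivative `∂ᵢ f`. -/
def pd {d : ℕ} (i : Fin d) (f : Space d → ℝ) (x : Space d) : ℝ :=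
  fderiv ℝ f x (EuclideanSpace.single i 1)

/-- The divergence `∇ · F`. -/
def divergence {d : ℕ} (F : Space d → Space d) (x : Space d) : ℝ :=
  ∑ i, pd i (fun y => F y i) x

/-- The entry `∂ᵢ uⱼ` of the velocity gradient, for indices `i, j` running over three coordinate
directions. A two-dimensional flow is regarded as the planar flow with `u₃ = 0` and `∂₃ = 0`. -/
def velGrad₃ {d : ℕ} (u : Space d → Space d) (x : Space d) (i j : Fin 3) : ℝ :=
  if h : (i : ℕ) < d ∧ (j : ℕ) < d then pd ⟨i, h.1⟩ (fun y => u y ⟨j, h.2⟩) x else 0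

/-! ### Dimensionless parameters and constitutive relations -/

/-- The dimensionless parameters: Reynolds number `Re`, numbers `β`, `ε`, `α_w`, static contact
angle `θs`, densities `ρ₁, ρ₂`, viscosities `η₁, η₂` and slip lengths `ls₁, ls₂` of the two phases,
bulk mobility `M` and wall mobility `MΓ` (functions of `c`, possibly constant). -/
structure FluidParams where
  Re : ℝ
  β : ℝ
  ε : ℝ
  αw : ℝ
  θs : ℝ
  ρ₁ : ℝ
  ρ₂ : ℝ
  η₁ : ℝ
  η₂ : ℝ
  ls₁ : ℝ
  ls₂ : ℝ
  M : ℝ → ℝ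
  MΓ : ℝ → ℝ
  Re_pos : 0 < Re
  β_pos : 0 < β
  ε_pos : 0 < ε
  ρ₁_pos : 0 < ρ₁
  ρ₂_pos : 0 < ρ₂
  η₁_pos : 0 < η₁
  η₂_pos : 0 < η₂
  ls₁_pos : 0 < ls₁
  ls₂_pos : 0 < ls₂
  M_smooth : ContDiff ℝ ∞ M

namespace FluidParams

variable (P : FluidParams)

/-- Specific volume of the mixture, `1 / ρ = c / ρ₁ + (1 - c) / ρ₂`. -/
def specificVolume (c : ℝ) : ℝ := c / P.ρ₁ + (1 - c) / P.ρ₂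

/-- Mixture density `ρ(c)`. -/
def ρ (c : ℝ) : ℝ := 1 / P.specificVolume c

/-- `1 / η = c / η₁ + (1 - c) / η₂`. -/
def fluidity (c : ℝ) : ℝ := c / P.η₁ + (1 - c) / P.η₂

/-- Mixture viscosity `η(c)`. -/
def η (c : ℝ) : ℝ := 1 / P.fluidity c

/-- Slip length `l_s(c)`: the inverse wall friction interpolates linearly in `c`. -/
def ls (c : ℝ) : ℝ := c * P.ls₁ + (1 - c) * P.ls₂

/-- `α = (ρ₂ - ρ₁) / (ρ₁ ρ₂)`. -/
def α : ℝ := (P.ρ₂ - P.ρ₁) / (P.ρ₁ * P.ρ₂)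

/-- Wall energy density `f_w(c) = -½ cos θ_s sin ((2c - 1) π / 2)`. -/
def fw (c : ℝ) : ℝ :=
  -(1 / 2) * Real.cos P.θs * Real.sin ((2 * c - 1) * Real.pi / 2)

end FluidParams

/-- Double-well potential `G(c) = c² (1 - c)² / 4`. -/
def doubleWell (c : ℝ) : ℝ := 1 / 4 * c ^ 2 * (1 - c) ^ 2

section Fields

variable {d : ℕ} (P : FluidParams)

/-- Mixing energy per unit mass, `G(c) / ε + (ε / 2) |∇c|²`. -/
def mixingEnergy (c : Space d → ℝ) (x : Space d) : ℝ :=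
  1 / P.ε * doubleWell (c x) + P.ε / 2 * ‖gradient c x‖ ^ 2

/-- Physical pressure `p`, recovered from `p̄ = p + ρ (G / ε + (ε / 2) |∇c|²)`. -/
def pressure (c pbar : Space d → ℝ) (x : Space d) : ℝ :=
  pbar x - P.ρ (c x) * mixingEnergy P c x

/-- Full chemical potential `μ̃ = μ̄ + α p̄`. -/
def muTilde (μbar pbar : Space d → ℝ) (x : Space d) : ℝ := μbar x + P.α * pbar x

/-- Entry `(i, j)` of the dimensionless stress
`σ_η = η (∇u + ∇uᵀ) - (2η/3) (∇ · u) I - (Re / β) p I`. -/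
def stress (c pbar : Space d → ℝ) (u : Space d → Space d) (x : Space d) (i j : Fin d) : ℝ :=
  P.η (c x) * (pd i (fun y => u y j) x + pd j (fun y => u y i) x)
    + if i = j then -(2 * P.η (c x) / 3) * divergence u x - P.Re / P.β * pressure P c pbar x else 0

/-- `L(c) = ε ρ ∂ₙc + α_w f_w'(c)` at the boundary point `x` with outer unit normal `n`. -/
def wallPotential (c : Space d → ℝ) (x n : Space d) : ℝ :=
  P.ε * P.ρ (c x) * inner ℝ n (gradient c x) + P.αw * deriv P.fw (c x)

/-- Tangential part `v - (v · n) n`. -/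
def tangential (n v : Space d) : Space d := v - (inner ℝ n v : ℝ) • n

/-- `f` is smooth on `I × K` up to the boundary: near each point of `I × K` it is a smooth function
of `(t, x)`. -/
def SmoothOnSpaceTime {F : Type*} [NormedAddCommGroup F] [NormedSpace ℝ F]
    (I : Set ℝ) (K : Set (Space d)) (f : ℝ → Space d → F) : Prop :=
  ∀ t ∈ I, ∀ x ∈ K, ContDiffAt ℝ ∞ (fun z : ℝ × Space d => f z.1 z.2) (t, x)

/-- `(c, μ̄, u, p̄)` is a smooth solution, for times in `I`, of the reformulated dimensionless
quasi-incompressible Navier-Stokes-Cahn-Hilliard system in `Ω`, with the dynamic contact line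
conditions and the generalised Navier slip condition on a fixed solid wall `∂Ω`. -/
structure IsSmoothSolution (Ω : Set (Space d)) (I : Set ℝ)
    (c μbar : ℝ → Space d → ℝ) (u : ℝ → Space d → Space d) (pbar : ℝ → Space d → ℝ) : Prop where
  smooth_c : SmoothOnSpaceTime I (closure Ω) c
  smooth_μbar : SmoothOnSpaceTime I (closure Ω) μbar
  smooth_u : SmoothOnSpaceTime I (closure Ω) u
  smooth_pbar : SmoothOnSpaceTime I (closure Ω) pbar
  /-- the density, the viscosity and the slip length are well defined and positive -/
  density_pos : ∀ t ∈ I, ∀ x ∈ closure Ω, 0 < P.specificVolume (c t x)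
  viscosity_pos : ∀ t ∈ I, ∀ x ∈ closure Ω, 0 < P.fluidity (c t x)
  slip_pos : ∀ t ∈ I, ∀ x ∈ frontier Ω, 0 < P.ls (c t x)
  /-- `ρ Dc/Dt = ∇ · (M ∇μ̄) + α ∇ · (M ∇p̄)` -/
  phase_eq : ∀ t ∈ I, ∀ x ∈ Ω,
    P.ρ (c t x) * (deriv (fun s => c s x) t + inner ℝ (u t x) (gradient (c t) x)) =
      divergence (fun y => P.M (c t y) • gradient (μbar t) y) x
        + P.α * divergence (fun y => P.M (c t y) • gradient (pbar t) y) x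
  /-- `μ̄ = G'(c) / ε - (ε / ρ) ∇ · (ρ ∇c) - α ρ (G / ε + (ε / 2) |∇c|²)` -/
  potential_eq : ∀ t ∈ I, ∀ x ∈ Ω,
    μbar t x = 1 / P.ε * deriv doubleWell (c t x)
      - P.ε / P.ρ (c t x) * divergence (fun y => P.ρ (c t y) • gradient (c t) y) x
      - P.α * P.ρ (c t x) * mixingEnergy P (c t) x
  /-- `Re ρ Du/Dt = ∇ · (η (∇u + ∇uᵀ)) - ∇ ((2η/3) ∇ · u) - (Re/β) ∇p̄ + (Re/β) ρ μ̄ ∇c` -/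
  momentum_eq : ∀ t ∈ I, ∀ x ∈ Ω, ∀ j : Fin d,
    P.Re * P.ρ (c t x) *
        (deriv (fun s => u s x) t j + ∑ i, u t x i * pd i (fun y => u t y j) x) =
      ∑ i, pd i (fun y => P.η (c t y) *
          (pd i (fun z => u t z j) y + pd j (fun z => u t z i) y)) x
        - pd j (fun y => 2 * P.η (c t y) / 3 * divergence (u t) y) x
        - P.Re / P.β * pd j (pbar t) x
        + P.Re / P.β * P.ρ (c t x) * μbar t x * pd j (c t) x
  /-- `∇ · u = α ∇ · (M ∇μ̄) + α² ∇ · (M ∇p̄)` -/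
  quasi_incompressible : ∀ t ∈ I, ∀ x ∈ Ω,
    divergence (u t) x =
      P.α * divergence (fun y => P.M (c t y) • gradient (μbar t) y) x
        + P.α ^ 2 * divergence (fun y => P.M (c t y) • gradient (pbar t) y) x
  /-- `∂c/∂t + u · ∇_Γ c = -M_Γ L(c)`, with `∇_Γ = ∇ - n (n · ∇)` -/
  wall_phase : ∀ t ∈ I, ∀ x ∈ frontier Ω, ∀ n, IsOuterUnitNormal Ω x n →
    deriv (fun s => c s x) t + inner ℝ (u t x) (tangential n (gradient (c t) x)) =
      -(P.MΓ (c t x) * wallPotential P (c t) x n)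
  /-- `∂ₙ μ̃ = 0` -/
  wall_flux : ∀ t ∈ I, ∀ x ∈ frontier Ω, ∀ n, IsOuterUnitNormal Ω x n →
    inner ℝ n (gradient (muTilde P (μbar t) (pbar t)) x) = 0
  /-- `u · n = 0` -/
  wall_impermeable : ∀ t ∈ I, ∀ x ∈ frontier Ω, ∀ n, IsOuterUnitNormal Ω x n →
    inner ℝ (u t x) n = 0
  /-- `l_s⁻¹ uˢ · τ = -n · σ_η · τ + (Re/β) L(c) ∂_τ c` for every tangent direction `τ` -/
  wall_slip : ∀ t ∈ I, ∀ x ∈ frontier Ω, ∀ n, IsOuterUnitNormal Ω x n →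
    ∀ τ : Space d, inner ℝ n τ = 0 →
      1 / P.ls (c t x) * inner ℝ (tangential n (u t x)) τ =
        -(∑ i, ∑ j, n i * stress P (c t) (pbar t) (u t) x i j * τ j)
          + P.Re / P.β * wallPotential P (c t) x n * inner ℝ τ (gradient (c t) x)

/-- The dimensionless total energy
`∫_Ω ρ|u|²/2 + (1/β) ∫_Ω ρ (G/ε + (ε/2)|∇c|²) + (α_w/β) ∫_{∂Ω} f_w(c) dS`. -/
def totalEnergy (Ω : Set (Space d)) (c : Space d → ℝ) (u : Space d → Space d) : ℝ :=
  (∫ x in Ω, P.ρ (c x) * ‖u x‖ ^ 2 / 2)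
    + 1 / P.β * (∫ x in Ω, P.ρ (c x) * mixingEnergy P c x)
    + P.αw / P.β * (∫ x, P.fw (c x) ∂surfaceMeasure Ω)

end Fields

end

/-!
The total energy obeys a local balance law whose flux, on the wall, combines with the rate of change
of the wall energy into the wall dissipation; integrating with the divergence theorem gives the
energy law.

*Local balance* (`IsSmoothSolution.local_energy_balance`). The density satisfies `ρ' = -α ρ²`, so the
phase equation and the quasi-incompressibility constraint together are the continuity equation, and
`kinetic_balance` turns the momentum equation into a balance of `ρ |u|² / 2`. The definition of `μ̄`
is arranged so that `∂ₜ (ρ e) = ∇ · (ε ρ ∂ₜc ∇c) + ρ μ̄ ∂ₜc`, where `e` is the mixing energy. The work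
`ρ μ̄ u · ∇c` of the capillary force completes `ρ μ̄ ∂ₜc` to `μ̄ ρ Dc/Dt`, the pressure work contributes
`α p̄ ρ Dc/Dt`, and `ρ Dc/Dt = ∇ · (M ∇μ̃)`; hence the sum is `∇ · (μ̃ M ∇μ̃) - M |∇μ̃|²`.

*Wall* (`IsSmoothSolution.wall_energy_balance`). Of the normal flux only the viscous power and
`ε ρ ∂ₜc ∂ₙc / β` survive. With the wall energy the latter becomes `L(c) ∂ₜc / β`; the dynamic
contact line condition for `∂ₜc` and the slip condition tested with `τ = u` cancel the term
`L(c) u · ∇c / β` and leave two squares.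

*Divergence theorem on Lipschitz domains* (`integral_fderiv_eq_surfaceIntegral`). Below the graph of
a Lipschitz function `φ`, the integral of `∂ᵥ g` is the derivative at `s = 0` of the integral of
`g (· + s v)`. Translating the region instead of `g` expresses the same derivative by the values of
`g` on the graph and by `∇φ`, which exists almost everywhere by Rademacher's theorem
(`integral_fderiv_subgraph`). The result is a surface integral by the area formula
(`IsGraphParam.restrict_range_eq_map`): on countably many pieces `φ` is nearly linear, and the metric
of the graph of a linear form is the Euclidean metric pulled back by a linear map of determinant
`√(1 + |∇φ|²)`. At points of differentiability the normal of the graph is the outer unit normal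
(`isOuterUnitNormal_subgraph`), and a smooth partition of unity globalises the statement.
-/

noncomputable section

/-! ### The area formula for Lipschitz graphs -/

/-- If `f` expands distances on `s` at most `K` times as much as `g`, then the Hausdorff measures
of the images of `s` compare accordingly. -/
theorem euclideanHausdorffMeasure_image_le_of_dist_le {ι X Y : Type*}
    [MetricSpace X] [MeasurableSpace X] [BorelSpace X]
    [MetricSpace Y] [MeasurableSpace Y] [BorelSpace Y] {f : ι → X} {g : ι → Y} {s : Set ι}
    {K : NNReal} (m : ℕ) (h : ∀ x ∈ s, ∀ y ∈ s, dist (f x) (f y) ≤ K * dist (g x) (g y)) :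
    Measure.euclideanHausdorffMeasure m (f '' s) ≤
      (K : ENNReal) ^ m * Measure.euclideanHausdorffMeasure m (g '' s) := by
  rcases s.eq_empty_or_nonempty with rfl | ⟨x₀, -⟩
  · simp
  have : ∀ y ∈ g '' s, ∃ x ∈ s, g x = y := fun y hy => hy
  choose k₀ hks₀ hkg₀ using this
  obtain ⟨k, hks, hkg⟩ : ∃ k : Y → ι, (∀ y ∈ g '' s, k y ∈ s) ∧ ∀ y ∈ g '' s, g (k y) = y := by
    classical
    refine ⟨fun y => if hy : y ∈ g '' s then k₀ y hy else x₀, fun y hy => ?_, fun y hy => ?_⟩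
    · simp only [dif_pos hy, hks₀]
    · simp only [dif_pos hy, hkg₀]
  have himage : f '' s = (f ∘ k) '' (g '' s) := by
    rw [image_image]
    refine image_congr fun x hx => ?_
    have hgx := mem_image_of_mem g hx
    have h1 := h x hx (k (g x)) (hks _ hgx)
    rw [hkg _ hgx, dist_self, mul_zero] at h1
    exact dist_le_zero.1 h1
  have hlip : LipschitzOnWith K (f ∘ k) (g '' s) := by
    refine LipschitzOnWith.of_dist_le_mul fun x hx y hy => ?_
    have := h _ (hks x hx) _ (hks y hy)
    rwa [hkg x hx, hkg y hy] at this
  have hH := hlip.hausdorffMeasure_image_le (d := m) (by positivity)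
  rw [← himage] at hH
  simp only [Measure.euclideanHausdorffMeasure_def, Measure.smul_apply, ENNReal.smul_def,
    smul_eq_mul]
  calc _ ≤ _ * ((K : ENNReal) ^ (m : ℝ) * Measure.hausdorffMeasure (m : ℝ) (g '' s)) :=
        mul_le_mul_right hH _
    _ = _ := by rw [ENNReal.rpow_natCast]; ring

theorem one_le_sqrt_one_add_sq (a : ℝ) : 1 ≤ √(1 + a ^ 2) := by
  rw [Real.one_le_sqrt]; nlinarith [sq_nonneg a]

theorem abs_sqrt_add_sq_sub_le {a b c d : ℝ} :
    |√(a ^ 2 + b ^ 2) - √(c ^ 2 + d ^ 2)| ≤ |a - c| + |b - d| := by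
  have key : ∀ a b c d : ℝ, √(a ^ 2 + b ^ 2) ≤ √(c ^ 2 + d ^ 2) + (|a - c| + |b - d|) := by
    intro a b c d
    have hs := Real.sqrt_nonneg (c ^ 2 + d ^ 2)
    have hc : |c| ≤ √(c ^ 2 + d ^ 2) := Real.abs_le_sqrt (by nlinarith)
    have hd : |d| ≤ √(c ^ 2 + d ^ 2) := Real.abs_le_sqrt (by nlinarith)
    refine Real.sqrt_le_iff.2 ⟨by positivity, ?_⟩
    have h2 := Real.sq_sqrt (show 0 ≤ c ^ 2 + d ^ 2 by positivity)
    have e1 : a ^ 2 ≤ c ^ 2 + 2 * |c| * |a - c| + |a - c| ^ 2 := by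
      have := abs_mul c (a - c)
      have h3 := le_abs_self (c * (a - c))
      have h4 := sq_abs (a - c)
      nlinarith
    have e2 : b ^ 2 ≤ d ^ 2 + 2 * |d| * |b - d| + |b - d| ^ 2 := by
      have := abs_mul d (b - d)
      have h3 := le_abs_self (d * (b - d))
      have h4 := sq_abs (b - d)
      nlinarith
    have e3 := mul_le_mul_of_nonneg_right hc (abs_nonneg (a - c))
    have e4 := mul_le_mul_of_nonneg_right hd (abs_nonneg (b - d))
    nlinarith [mul_nonneg (abs_nonneg (a - c)) (abs_nonneg (b - d))]
  rw [abs_sub_le_iff]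
  constructor
  · linarith [key a b c d]
  · have := key c d a b
    rw [abs_sub_comm c, abs_sub_comm d] at this
    linarith

section GraphParam

variable {V X : Type*} [NormedAddCommGroup V] [MetricSpace X] {φ : V → ℝ} {Φ : V → X}

/-- `Φ` parametrises a copy of the graph of `φ`: distances between values of `Φ` are the distances
between the corresponding points of the graph. -/
def IsGraphParam (φ : V → ℝ) (Φ : V → X) : Prop :=
  ∀ x y, dist (Φ x) (Φ y) = √(‖x - y‖ ^ 2 + (φ x - φ y) ^ 2)

theorem IsGraphParam.norm_sub_le (h : IsGraphParam φ Φ) (x y : V) :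
    ‖x - y‖ ≤ dist (Φ x) (Φ y) := by
  rw [h]; exact Real.le_sqrt_of_sq_le (by nlinarith [sq_nonneg (φ x - φ y)])

theorem IsGraphParam.lipschitz (h : IsGraphParam φ Φ) {K : NNReal} (hφ : LipschitzWith K φ) :
    LipschitzWith (1 + K) Φ := by
  refine LipschitzWith.of_dist_le_mul fun x y => ?_
  rw [h]
  refine Real.sqrt_le_iff.2 ⟨by positivity, ?_⟩
  have h1 := hφ.dist_le_mul x y
  rw [Real.dist_eq] at h1
  have h2 : (φ x - φ y) ^ 2 ≤ (K * dist x y) ^ 2 := sq_le_sq' (by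
    linarith [neg_abs_le (φ x - φ y)]) ((le_abs_self _).trans h1)
  rw [← dist_eq_norm]
  push_cast
  nlinarith [mul_nonneg K.coe_nonneg (sq_nonneg (dist x y))]

theorem IsGraphParam.isClosedEmbedding [NormedSpace ℝ V] [FiniteDimensional ℝ V]
    (h : IsGraphParam φ Φ) {K : NNReal}
    (hφ : LipschitzWith K φ) : Topology.IsClosedEmbedding Φ := by
  have := FiniteDimensional.complete ℝ V
  refine AntilipschitzWith.isClosedEmbedding (K := 1)
    (AntilipschitzWith.of_le_mul_dist fun x y => ?_) (h.lipschitz hφ).uniformContinuous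
  rw [NNReal.coe_one, one_mul, dist_eq_norm]
  exact h.norm_sub_le x y

end GraphParam

section Graph

variable {V : Type*} [NormedAddCommGroup V] [NormedSpace ℝ V]

/-- The area element `√(1 + |∇φ|²)` of the graph of `φ`. -/
def graphJacobian (φ : V → ℝ) (z : V) : ℝ := √(1 + ‖fderiv ℝ φ z‖ ^ 2)

theorem measurable_graphJacobian [MeasurableSpace V] [BorelSpace V] (φ : V → ℝ) :
    Measurable (graphJacobian φ) := by
  unfold graphJacobian
  have := (measurable_fderiv ℝ φ).norm
  fun_prop

end Graph

section Graph

variable {V : Type*} [NormedAddCommGroup V] [InnerProductSpace ℝ V] [FiniteDimensional ℝ V]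

/-- The metric that the graph of a linear form `ℓ` induces on its domain is the Euclidean metric
transformed by a linear map of determinant `√(1 + |ℓ|²)`. -/
theorem exists_linearMap_norm_sq_eq (ℓ : V →L[ℝ] ℝ) :
    ∃ T : V →ₗ[ℝ] V, (∀ v, ‖T v‖ ^ 2 = ‖v‖ ^ 2 + (ℓ v) ^ 2) ∧
      LinearMap.det T = √(1 + ‖ℓ‖ ^ 2) := by
  have := FiniteDimensional.complete ℝ V
  set g : V := (InnerProductSpace.toDual ℝ V).symm ℓ with hg
  have hgl : ∀ v, ℓ v = inner ℝ g v := fun v => by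
    rw [hg, InnerProductSpace.toDual_symm_apply]
  have hgn : ‖g‖ = ‖ℓ‖ := by simp [hg]
  set J : ℝ := √(1 + ‖ℓ‖ ^ 2) with hJ
  have hJ1 : 1 ≤ J := one_le_sqrt_one_add_sq _
  have hJ2 : J ^ 2 = 1 + ‖g‖ ^ 2 := by rw [hJ, Real.sq_sqrt (by positivity), hgn]
  have hgg : ‖g‖ ^ 2 = J ^ 2 - 1 := by linarith
  refine ⟨LinearMap.transvection (ℓ : V →ₗ[ℝ] ℝ) ((1 / (1 + J)) • g), fun v => ?_, ?_⟩
  · rw [LinearMap.transvection.apply, norm_add_sq_real]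
    simp only [ContinuousLinearMap.coe_coe, norm_smul, inner_smul_right, mul_pow,
      Real.norm_eq_abs, sq_abs, hgg]
    rw [real_inner_comm, ← hgl]
    have : 1 + J ≠ 0 := by positivity
    field_simp
    ring
  · rw [LinearMap.transvection.det, ContinuousLinearMap.coe_coe, map_smul, hgl,
      real_inner_self_eq_norm_sq, hgg, smul_eq_mul]
    have : 1 + J ≠ 0 := by positivity
    field_simp
    ring

variable [MeasurableSpace V] [BorelSpace V]
variable {X : Type*} [MetricSpace X] [MeasurableSpace X] [BorelSpace X]
variable {φ : V → ℝ} {Φ : V → X}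

/-- On a set where `φ` is close to a linear form `ℓ`, the area of the graph of `φ` is close to
that of the graph of `ℓ`. -/
theorem IsGraphParam.image_bounds (h : IsGraphParam φ Φ) {ℓ : V →L[ℝ] ℝ} {s : Set V}
    {δ : NNReal} (hδ : δ ≤ 1 / 2) (hs : ApproximatesLinearOn φ ℓ s δ) :
    Measure.euclideanHausdorffMeasure (Module.finrank ℝ V) (Φ '' s) ≤
        ((1 + 2 * δ : NNReal) : ENNReal) ^ Module.finrank ℝ V *
          (ENNReal.ofReal √(1 + ‖ℓ‖ ^ 2) * volume s) ∧
      ENNReal.ofReal √(1 + ‖ℓ‖ ^ 2) * volume s ≤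
        ((1 + 2 * δ : NNReal) : ENNReal) ^ Module.finrank ℝ V *
          Measure.euclideanHausdorffMeasure (Module.finrank ℝ V) (Φ '' s) := by
  obtain ⟨T, hT, hdet⟩ := exists_linearMap_norm_sq_eq ℓ
  have hvol : ENNReal.ofReal √(1 + ‖ℓ‖ ^ 2) * volume s =
      Measure.euclideanHausdorffMeasure (Module.finrank ℝ V) (T '' s) := by
    rw [InnerProductSpace.euclideanHausdorffMeasure_eq_volume, Measure.addHaar_image_linearMap,
      hdet, abs_of_nonneg (Real.sqrt_nonneg _)]
  have hδ' : (δ : ℝ) ≤ 1 / 2 := by exact_mod_cast hδ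
  have hTd : ∀ x y, dist (T x) (T y) = √(‖x - y‖ ^ 2 + (ℓ (x - y)) ^ 2) := fun x y => by
    rw [dist_eq_norm, ← map_sub, ← hT, Real.sqrt_sq (norm_nonneg _)]
  have hclose : ∀ x ∈ s, ∀ y ∈ s,
      |dist (Φ x) (Φ y) - dist (T x) (T y)| ≤ δ * ‖x - y‖ := fun x hx y hy => by
    rw [h, hTd]
    refine abs_sqrt_add_sq_sub_le.trans ?_
    rw [sub_self, abs_zero, zero_add]
    exact hs x hx y hy
  have hTle : ∀ x y, ‖x - y‖ ≤ dist (T x) (T y) := fun x y => by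
    rw [hTd]; exact Real.le_sqrt_of_sq_le (by nlinarith [sq_nonneg (ℓ (x - y))])
  rw [hvol]
  constructor
  · refine euclideanHausdorffMeasure_image_le_of_dist_le _ fun x hx y hy => ?_
    have h1 := (abs_le.1 (hclose x hx y hy)).2
    have h2 := mul_le_mul_of_nonneg_left (hTle x y) δ.coe_nonneg
    push_cast
    nlinarith [mul_nonneg δ.coe_nonneg (dist_nonneg (x := T x) (y := T y))]
  · refine euclideanHausdorffMeasure_image_le_of_dist_le _ fun x hx y hy => ?_
    have h1 := (abs_le.1 (hclose x hx y hy)).1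
    have h2 := mul_le_mul_of_nonneg_left (h.norm_sub_le x y) δ.coe_nonneg
    have h3 := dist_nonneg (x := Φ x) (y := Φ y)
    push_cast
    nlinarith [mul_nonneg δ.coe_nonneg h3]

/-- The comparison of areas used to prove the area formula, with a relative error `K - 1`. -/
theorem IsGraphParam.image_bounds_lintegral (h : IsGraphParam φ Φ) {L : NNReal}
    (hφ : LipschitzWith L φ) {δ : NNReal} (hδ0 : 0 < δ) (hδ : δ ≤ 1 / 2) {A : Set V}
    (hA : MeasurableSet A) :
    Measure.euclideanHausdorffMeasure (Module.finrank ℝ V) (Φ '' A) ≤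
        ((1 + 2 * δ : NNReal) : ENNReal) ^ (Module.finrank ℝ V + 1) *
          ∫⁻ z in A, ENNReal.ofReal (graphJacobian φ z) ∧
      ∫⁻ z in A, ENNReal.ofReal (graphJacobian φ z) ≤
        ((1 + 2 * δ : NNReal) : ENNReal) ^ (Module.finrank ℝ V + 1) *
          Measure.euclideanHausdorffMeasure (Module.finrank ℝ V) (Φ '' A) := by
  have := FiniteDimensional.complete ℝ V
  set m := Module.finrank ℝ V
  set K : ENNReal := ((1 + 2 * δ : NNReal) : ENNReal) with hK
  have hemb := (h.isClosedEmbedding hφ).measurableEmbedding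
  set ν : Measure V := Measure.comap Φ (Measure.euclideanHausdorffMeasure m) with hν
  have hνa : ∀ s, ν s = Measure.euclideanHausdorffMeasure m (Φ '' s) := hemb.comap_apply _
  set μ : Measure V := volume.withDensity fun z => ENNReal.ofReal (graphJacobian φ z) with hμ
  have hJm : Measurable fun z => ENNReal.ofReal (graphJacobian φ z) :=
    (measurable_graphJacobian φ).ennreal_ofReal
  rw [← hνa, ← withDensity_apply _ hA, ← hμ]
  set D : Set V := {z | DifferentiableAt ℝ φ z} with hD
  have hDm : MeasurableSet D := measurableSet_of_differentiableAt ℝ φ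
  have hDc : volume Dᶜ = 0 := by
    have := hφ.ae_differentiableAt (μ := (volume : Measure V))
    exact this
  have hνD : ν Dᶜ = 0 := by
    rw [hνa]
    have := euclideanHausdorffMeasure_image_le_of_dist_le (f := Φ) (g := (id : V → V)) (s := Dᶜ)
      (K := 1 + L) m fun x _ y _ => (h.lipschitz hφ).dist_le_mul x y
    rw [image_id, InnerProductSpace.euclideanHausdorffMeasure_eq_volume, hDc, mul_zero] at this
    exact le_antisymm this zero_le
  have hμD : μ Dᶜ = 0 := withDensity_absolutelyContinuous _ _ hDc
  -- pieces on which the derivative of `φ` oscillates by at most `δ`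
  obtain ⟨q, hq⟩ := TopologicalSpace.exists_dense_seq (V →L[ℝ] ℝ)
  set Q : ℕ → Set (V →L[ℝ] ℝ) := disjointed fun j => Metric.ball (q j) (δ / 2) with hQ
  have hQm : ∀ j, MeasurableSet (Q j) :=
    fun j => MeasurableSet.disjointed (fun j => measurableSet_ball) j
  have hQu : ⋃ j, Q j = univ := by
    rw [hQ, iUnion_disjointed]
    refine eq_univ_of_forall fun x => ?_
    obtain ⟨j, hj⟩ := hq.exists_dist_lt x (show (0 : ℝ) < δ / 2 by positivity)
    exact mem_iUnion.2 ⟨j, hj⟩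
  have hQd : ∀ j, ∀ a ∈ Q j, ∀ b ∈ Q j, ‖a - b‖ ≤ δ := fun j a ha b hb => by
    have h1 := disjointed_subset _ j ha
    have h2 := disjointed_subset _ j hb
    rw [Metric.mem_ball] at h1 h2
    rw [← dist_eq_norm]
    linarith [dist_triangle_right a b (q j)]
  -- pieces on which `φ` is close to a linear form
  have hpart : ∀ j, ∃ (t : ℕ → Set V) (B : ℕ → V →L[ℝ] ℝ),
      Pairwise (Function.onFun Disjoint t) ∧ (∀ n, MeasurableSet (t n)) ∧
      (D ∩ fderiv ℝ φ ⁻¹' Q j ⊆ ⋃ n, t n) ∧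
      (∀ n, ApproximatesLinearOn φ (B n) ((D ∩ fderiv ℝ φ ⁻¹' Q j) ∩ t n) δ) ∧
      ((D ∩ fderiv ℝ φ ⁻¹' Q j).Nonempty → ∀ n, ∃ y ∈ D ∩ fderiv ℝ φ ⁻¹' Q j,
        B n = fderiv ℝ φ y) := fun j =>
    exists_partition_approximatesLinearOn_of_hasFDerivWithinAt φ _ (fderiv ℝ φ)
      (fun x hx => hx.1.hasFDerivAt.hasFDerivWithinAt) (fun _ => δ) fun _ => hδ0.ne'
  choose t B htd htm htu htB hB using hpart
  set S : ℕ × ℕ → Set V := fun i => (D ∩ fderiv ℝ φ ⁻¹' Q i.1) ∩ t i.1 i.2 with hS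
  have hSm : ∀ i, MeasurableSet (S i) := fun i =>
    (hDm.inter (measurable_fderiv ℝ φ (hQm i.1))).inter (htm _ _)
  have hSd : Pairwise (Function.onFun Disjoint S) := by
    rintro ⟨j, n⟩ ⟨j', n'⟩ hne
    rw [Function.onFun, Set.disjoint_left]
    rintro x ⟨⟨-, hx1⟩, hx2⟩ ⟨⟨-, hx3⟩, hx4⟩
    have hj : j = j' := by
      by_contra hjj
      exact Set.disjoint_left.1
        (disjoint_disjointed (fun j => Metric.ball (q j) (δ / 2 : ℝ)) hjj) hx1 hx3
    subst hj
    have hn : n = n' := by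
      by_contra hnn
      exact Set.disjoint_left.1 (htd j hnn) hx2 hx4
    exact hne (by rw [hn])
  have hSu : ⋃ i, S i = D := by
    refine Subset.antisymm (iUnion_subset fun i x hx => hx.1.1) fun x hx => ?_
    obtain ⟨j, hj⟩ := mem_iUnion.1 (hQu ▸ mem_univ (fderiv ℝ φ x))
    obtain ⟨n, hn⟩ := mem_iUnion.1 (htu j ⟨hx, hj⟩)
    exact mem_iUnion.2 ⟨(j, n), ⟨hx, hj⟩, hn⟩
  have hdecomp : ∀ κ : Measure V, κ Dᶜ = 0 → κ A = ∑' i, κ (A ∩ S i) := fun κ hκ => by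
    rw [← measure_iUnion (fun i j hij => (hSd hij).mono inter_subset_right inter_subset_right)
      fun i => hA.inter (hSm i), ← inter_iUnion, hSu]
    exact (measure_inter_conull hκ).symm
  have hpiece : ∀ i, ν (A ∩ S i) ≤ K ^ (m + 1) * μ (A ∩ S i) ∧
      μ (A ∩ S i) ≤ K ^ (m + 1) * ν (A ∩ S i) := by
    rintro ⟨j, n⟩
    rcases (D ∩ fderiv ℝ φ ⁻¹' Q j).eq_empty_or_nonempty with he | hne
    · have : S (j, n) = ∅ := by simp only [hS, he, empty_inter]
      simp [this]
    obtain ⟨y, hy, hBy⟩ := hB j hne n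
    set J₀ : ℝ := √(1 + ‖B j n‖ ^ 2) with hJ₀
    have hJ₀1 : 1 ≤ J₀ := one_le_sqrt_one_add_sq _
    have hJclose : ∀ z ∈ A ∩ S (j, n), |graphJacobian φ z - J₀| ≤ δ := fun z hz => by
      have h1 : ‖fderiv ℝ φ z - B j n‖ ≤ δ := by
        rw [hBy]; exact hQd j _ hz.2.1.2 _ hy.2
      have h2 := abs_sqrt_add_sq_sub_le (a := 1) (b := ‖fderiv ℝ φ z‖) (c := 1) (d := ‖B j n‖)
      rw [one_pow, sub_self, abs_zero, zero_add] at h2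
      exact h2.trans ((abs_norm_sub_norm_le _ _).trans h1)
    have hJ1 : ∀ z, 1 ≤ graphJacobian φ z := fun z => one_le_sqrt_one_add_sq _
    have hKr : K = ENNReal.ofReal (1 + 2 * δ) := by
      rw [hK, ENNReal.ofReal, Real.toNNReal_of_nonneg (by positivity)]
      norm_cast
    have hms : MeasurableSet (A ∩ S (j, n)) := hA.inter (hSm _)
    have hμ1 : μ (A ∩ S (j, n)) ≤ K * (ENNReal.ofReal J₀ * volume (A ∩ S (j, n))) := by
      rw [hμ, withDensity_apply _ hms, ← mul_assoc, ← setLIntegral_const]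
      refine setLIntegral_mono' hms fun z hz => ?_
      rw [hKr, ← ENNReal.ofReal_mul (by positivity)]
      refine ENNReal.ofReal_le_ofReal ?_
      have := (abs_le.1 (hJclose z hz)).2
      nlinarith [mul_nonneg δ.coe_nonneg (sub_nonneg.2 hJ₀1), δ.coe_nonneg]
    have hμ2 : ENNReal.ofReal J₀ * volume (A ∩ S (j, n)) ≤ K * μ (A ∩ S (j, n)) := by
      rw [hμ, withDensity_apply _ hms, ← lintegral_const_mul _ hJm, ← setLIntegral_const]
      refine setLIntegral_mono' hms fun z hz => ?_
      rw [hKr, ← ENNReal.ofReal_mul (by positivity)]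
      refine ENNReal.ofReal_le_ofReal ?_
      have := (abs_le.1 (hJclose z hz)).1
      nlinarith [mul_nonneg δ.coe_nonneg (sub_nonneg.2 (hJ1 z)), δ.coe_nonneg]
    have hb := h.image_bounds hδ ((htB j n).mono_set (s := A ∩ S (j, n)) inter_subset_right)
    rw [← hνa, ← hJ₀, ← hK] at hb
    constructor
    · calc ν (A ∩ S (j, n)) ≤ K ^ m * (ENNReal.ofReal J₀ * volume (A ∩ S (j, n))) := hb.1
        _ ≤ K ^ m * (K * μ (A ∩ S (j, n))) := mul_le_mul_right hμ2 _
        _ = _ := by rw [pow_succ, mul_assoc]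
    · calc μ (A ∩ S (j, n)) ≤ K * (ENNReal.ofReal J₀ * volume (A ∩ S (j, n))) := hμ1
        _ ≤ K * (K ^ m * ν (A ∩ S (j, n))) := mul_le_mul_right hb.2 _
        _ = _ := by rw [pow_succ']; ring
  rw [hdecomp ν hνD, hdecomp μ hμD]
  constructor
  · rw [← ENNReal.tsum_mul_left]
    exact ENNReal.tsum_le_tsum fun i => (hpiece i).1
  · rw [← ENNReal.tsum_mul_left]
    exact ENNReal.tsum_le_tsum fun i => (hpiece i).2

theorem ENNReal_le_of_forall_pow_mul_le {a b : ENNReal} {n : ℕ}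
    (h : ∀ δ : NNReal, 0 < δ → δ ≤ 1 / 2 → a ≤ ((1 + 2 * δ : NNReal) : ENNReal) ^ n * b) :
    a ≤ b := by
  have hc : Tendsto (fun δ : NNReal => ((1 + 2 * δ : NNReal) : ENNReal) ^ n * b) (𝓝[>] 0)
      (𝓝 (((1 + 2 * 0 : NNReal) : ENNReal) ^ n * b)) := by
    refine ENNReal.Tendsto.mul_const ?_ (Or.inl (by simp))
    refine Tendsto.mono_left ?_ nhdsWithin_le_nhds
    have : Continuous fun δ : NNReal => ((1 + 2 * δ : NNReal) : ENNReal) ^ n := by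
      simp_rw [← ENNReal.coe_pow]
      exact ENNReal.continuous_coe.comp (by fun_prop)
    exact this.tendsto 0
  simp only [mul_zero, add_zero, ENNReal.coe_one, one_pow, one_mul] at hc
  refine ge_of_tendsto hc ?_
  have : Ioo (0 : NNReal) (1 / 2) ∈ 𝓝[>] (0 : NNReal) := Ioo_mem_nhdsGT (by norm_num)
  filter_upwards [this] with δ hδ using h δ hδ.1 hδ.2.le

/-- **Area formula for Lipschitz graphs**: the Hausdorff measure on the graph of `φ` is the image
of the measure with density `√(1 + |∇φ|²)`. -/
theorem IsGraphParam.restrict_range_eq_map (h : IsGraphParam φ Φ) {L : NNReal}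
    (hφ : LipschitzWith L φ) :
    (Measure.euclideanHausdorffMeasure (Module.finrank ℝ V)).restrict (range Φ) =
      Measure.map Φ (volume.withDensity fun z => ENNReal.ofReal (graphJacobian φ z)) := by
  have hemb := (h.isClosedEmbedding hφ).measurableEmbedding
  rw [← hemb.map_comap]
  congr 1
  ext A hA
  rw [hemb.comap_apply, withDensity_apply _ hA]
  exact le_antisymm
    (ENNReal_le_of_forall_pow_mul_le fun δ h0 h1 => (h.image_bounds_lintegral hφ h0 h1 hA).1)
    (ENNReal_le_of_forall_pow_mul_le fun δ h0 h1 => (h.image_bounds_lintegral hφ h0 h1 hA).2)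

end Graph

/-! ### The divergence theorem on the region below a Lipschitz graph -/

theorem hasDerivAt_setIntegral_Iio {f : ℝ → ℝ} (hf : Continuous f) (hfi : Integrable f) (r : ℝ) :
    HasDerivAt (fun a => ∫ s in Iio a, f s) (f r) r := by
  have h1 : (fun a => ∫ s in Iio a, f s) =
      fun a => (∫ s in Iic 0, f s) + ∫ s in (0 : ℝ)..a, f s := by
    ext a
    rw [← intervalIntegral.integral_Iic_sub_Iic hfi.integrableOn hfi.integrableOn,
      setIntegral_congr_set Iio_ae_eq_Iic]
    ring
  rw [h1]
  exact (intervalIntegral.integral_hasDerivAt_right (hf.intervalIntegrable _ _)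
    (hf.stronglyMeasurableAtFilter _ _) hf.continuousAt).const_add _

theorem abs_setIntegral_Iio_sub_le {f : ℝ → ℝ} (hfi : Integrable f) {M : ℝ}
    (hM : ∀ s, |f s| ≤ M) (a b : ℝ) :
    |(∫ s in Iio a, f s) - ∫ s in Iio b, f s| ≤ M * |a - b| := by
  rw [setIntegral_congr_set (Iio_ae_eq_Iic (a := a)),
    setIntegral_congr_set (Iio_ae_eq_Iic (a := b)),
    intervalIntegral.integral_Iic_sub_Iic hfi.integrableOn hfi.integrableOn]
  exact intervalIntegral.norm_integral_le_of_norm_le_const (f := f) fun x _ => hM x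

/-- Differentiation of a translated integral under the integral sign. -/
theorem hasDerivAt_setIntegral_translate {E : Type*} [NormedAddCommGroup E] [NormedSpace ℝ E]
    [FiniteDimensional ℝ E] [MeasurableSpace E] [BorelSpace E] {μ : Measure E}
    [IsFiniteMeasureOnCompacts μ] {g : E → ℝ} (hg : ContDiff ℝ 1 g) (hgc : HasCompactSupport g)
    (U : Set E) (w : E) :
    HasDerivAt (fun t : ℝ => ∫ p in U, g (p + t • w) ∂μ) (∫ p in U, fderiv ℝ g p w ∂μ) 0 := by
  have hprop : ProperSpace E := FiniteDimensional.proper ℝ E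
  obtain ⟨C, hC⟩ := hg.lipschitzWith_of_hasCompactSupport hgc one_ne_zero
  set K' : Set E := Metric.cthickening ‖w‖ (tsupport g) with hK'
  have hK'c : IsCompact K' := IsCompact.cthickening hgc
  have hzero : ∀ p ∉ K', ∀ t ∈ Metric.ball (0 : ℝ) 1, g (p + t • w) = 0 := by
    intro p hp t ht
    by_contra hne
    refine hp (Metric.mem_cthickening_of_dist_le p (p + t • w) _ _
      (subset_tsupport g hne) ?_)
    rw [dist_self_add_right, norm_smul]
    rw [mem_ball_zero_iff] at ht
    nlinarith [norm_nonneg w]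
  refine (hasDerivAt_integral_of_dominated_loc_of_lip (F := fun (t : ℝ) p => g (p + t • w))
    (bound := K'.indicator fun _ => C * ‖w‖) (Metric.ball_mem_nhds (0 : ℝ) one_pos)
    ?_ ?_ ?_ ?_ ?_ ?_).2
  · refine Eventually.of_forall fun t => ?_
    exact (hg.continuous.comp (by fun_prop)).aestronglyMeasurable
  · simp only [zero_smul, add_zero]
    exact (hg.continuous.integrable_of_hasCompactSupport hgc).integrableOn
  · exact ((hg.continuous_fderiv one_ne_zero).clm_apply continuous_const).aestronglyMeasurable
  · refine Eventually.of_forall fun p => LipschitzOnWith.of_dist_le_mul fun s hs t ht => ?_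
    by_cases hp : p ∈ K'
    · refine (hC.dist_le_mul _ _).trans (le_of_eq ?_)
      rw [indicator_of_mem hp, Real.coe_nnabs, abs_of_nonneg (by positivity), dist_add_left,
        dist_eq_norm, ← sub_smul, norm_smul, Real.dist_eq, Real.norm_eq_abs]
      ring
    · simp only [hzero p hp s hs, hzero p hp t ht, dist_self]
      positivity
  · exact ((integrable_indicator_iff hK'c.measurableSet).2
      (integrableOn_const hK'c.measure_lt_top.ne)).integrableOn
  · refine Eventually.of_forall fun p => ?_
    have h1 : HasFDerivAt g (fderiv ℝ g p) (p + (0 : ℝ) • w) := by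
      rw [zero_smul, add_zero]; exact (hg.differentiable one_ne_zero p).hasFDerivAt
    have h2 : HasDerivAt (fun t : ℝ => p + t • w) w 0 := by
      simpa using ((hasDerivAt_id (0 : ℝ)).smul_const w).const_add p
    exact h1.comp_hasDerivAt (0 : ℝ) h2

/-- **Divergence theorem below a Lipschitz graph**, in graph coordinates, for the derivative in the
direction `(a, b)` of a compactly supported function. Both sides are the derivative at `t = 0` of
the integral of `G (p + t (a, b))`: translating the region instead of the function reduces the
claim to Rademacher's theorem for `φ`. -/
theorem integral_fderiv_subgraph {V : Type*} [NormedAddCommGroup V] [InnerProductSpace ℝ V]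
    [FiniteDimensional ℝ V] [MeasurableSpace V] [BorelSpace V] {φ : V → ℝ} {L : NNReal}
    (hφ : LipschitzWith L φ) {G : V × ℝ → ℝ} (hG : ContDiff ℝ 1 G) (hGc : HasCompactSupport G)
    (a : V) (b : ℝ) :
    ∫ p in {p : V × ℝ | p.2 < φ p.1}, fderiv ℝ G p (a, b) =
      ∫ z, G (z, φ z) * (b - fderiv ℝ φ z a) := by
  have hprop : ProperSpace V := FiniteDimensional.proper ℝ V
  set U : Set (V × ℝ) := {p : V × ℝ | p.2 < φ p.1} with hU
  have hφc := hφ.continuous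
  have hUm : MeasurableSet U :=
    (isOpen_lt continuous_snd (hφc.comp continuous_fst)).measurableSet
  have hGi : Integrable G := hG.continuous.integrable_of_hasCompactSupport hGc
  obtain ⟨M, hM⟩ := hGc.exists_bound_of_continuous hG.continuous
  have hM0 : 0 ≤ M := (norm_nonneg _).trans (hM 0)
  have hslice_cont : ∀ z, Continuous fun s => G (z, s) := fun z => hG.continuous.comp (by fun_prop)
  have hslice : ∀ z, Integrable fun s => G (z, s) := fun z => by
    refine (hslice_cont z).integrable_of_hasCompactSupport ?_
    refine HasCompactSupport.intro (hGc.image continuous_snd) fun s hs => ?_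
    by_contra hne
    exact hs ⟨(z, s), subset_tsupport G hne, rfl⟩
  set S : Set V := Prod.fst '' tsupport G with hS
  have hSc : IsCompact S := hGc.image continuous_fst
  have hSz : ∀ z ∉ S, ∀ s, G (z, s) = 0 := fun z hz s => by
    by_contra hne
    exact hz ⟨(z, s), subset_tsupport G hne, rfl⟩
  set F : ℝ → V → ℝ := fun t z => ∫ s in Iio (φ (z - t • a) + t * b), G (z, s) with hF
  set f : ℝ → V × ℝ → ℝ := fun t p => U.indicator (fun _ => G p) (p - t • (a, b)) with hf
  have hfi : ∀ t, Integrable (f t) := fun t => by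
    have hm : MeasurableSet ((fun p : V × ℝ => p - t • (a, b)) ⁻¹' U) :=
      (measurable_id.sub_const _) hUm
    have : f t = ((fun p : V × ℝ => p - t • (a, b)) ⁻¹' U).indicator G := by
      ext p; simp only [hf, indicator, mem_preimage]
    rw [this]
    exact hGi.indicator hm
  have hfF : ∀ t z, ∫ s, f t (z, s) = F t z := fun t z => by
    simp only [hF]
    rw [← integral_indicator measurableSet_Iio]
    congr 1
    ext s
    have : (z, s) - t • (a, b) ∈ U ↔ s ∈ Iio (φ (z - t • a) + t * b) := by
      simp only [hU, mem_ofPred_eq, Prod.smul_mk, Prod.mk_sub_mk, smul_eq_mul, mem_Iio,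
        sub_lt_iff_lt_add]
    simp only [hf, indicator, this]
  have hkey : ∀ t : ℝ, ∫ p in U, G (p + t • (a, b)) = ∫ z, F t z := fun t => by
    simp_rw [← hfF]
    rw [← integral_prod _ (hfi t), ← integral_indicator hUm]
    rw [← integral_add_right_eq_self (μ := (volume : Measure V).prod (volume : Measure ℝ))
      (f t) (t • (a, b))]
    refine integral_congr_ae (Eventually.of_forall fun p => ?_)
    simp only [hf, add_sub_cancel_right, indicator]
  -- the same derivative, computed under the integral sign and through the moving upper limit
  have hd1 := hasDerivAt_setIntegral_translate (μ := (volume : Measure (V × ℝ))) hG hGc U (a, b)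
  simp_rw [hkey] at hd1
  have hFlip : ∀ z, LipschitzOnWith (Real.nnabs (S.indicator (fun _ => M * (L * ‖a‖ + |b|)) z))
      (F · z) univ := fun z => by
    refine LipschitzOnWith.of_dist_le_mul fun s _ t _ => ?_
    by_cases hz : z ∈ S
    · rw [indicator_of_mem hz, Real.coe_nnabs, abs_of_nonneg (by positivity), Real.dist_eq]
      refine (abs_setIntegral_Iio_sub_le (hslice z) (fun s => hM (z, s)) _ _).trans ?_
      rw [mul_assoc]
      refine mul_le_mul_of_nonneg_left ?_ hM0
      have h1 := hφ.dist_le_mul (z - s • a) (z - t • a)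
      rw [dist_sub_left, dist_eq_norm (s • a), ← sub_smul, norm_smul, Real.dist_eq] at h1
      rw [Real.dist_eq, ← Real.norm_eq_abs (s - t)]
      calc |φ (z - s • a) + s * b - (φ (z - t • a) + t * b)|
          = |(φ (z - s • a) - φ (z - t • a)) + (s - t) * b| := by congr 1; ring
        _ ≤ |φ (z - s • a) - φ (z - t • a)| + |(s - t) * b| := abs_add_le _ _
        _ ≤ L * (‖s - t‖ * ‖a‖) + ‖s - t‖ * |b| := by
            rw [abs_mul]; exact add_le_add h1 (le_of_eq (by rw [Real.norm_eq_abs]))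
        _ = _ := by ring
    · simp only [hF, hSz z hz, integral_zero, dist_self]
      positivity
  have hd2 := (hasDerivAt_integral_of_dominated_loc_of_lip (F := F) (μ := (volume : Measure V))
    (F' := fun z => G (z, φ z) * (b - fderiv ℝ φ z a)) (x₀ := (0 : ℝ))
    (bound := S.indicator fun _ => M * (L * ‖a‖ + |b|)) univ_mem
    (Eventually.of_forall fun t => ?_) ?_ ?_ (Eventually.of_forall hFlip) ?_ ?_).2
  · exact hd1.unique hd2
  · rw [← funext (hfF t)]
    exact (hfi t).integral_prod_left.aestronglyMeasurable
  · rw [← funext (hfF 0)]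
    exact (hfi 0).integral_prod_left
  · have h1 : Measurable fun z => fderiv ℝ φ z a := measurable_fderiv_apply_const ℝ φ a
    have h2 : Measurable fun z => G (z, φ z) :=
      (hG.continuous.comp (continuous_id.prodMk hφc)).measurable
    exact (h2.mul (measurable_const.sub h1)).aestronglyMeasurable
  · exact (integrable_indicator_iff hSc.measurableSet).2
      (integrableOn_const hSc.measure_lt_top.ne)
  · filter_upwards [hφ.ae_differentiableAt (μ := (volume : Measure V))] with z hz
    have h1 : HasFDerivAt φ (fderiv ℝ φ z) (z - (0 : ℝ) • a) := by
      rw [zero_smul, sub_zero]; exact hz.hasFDerivAt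
    have h2 : HasDerivAt (fun t : ℝ => z - t • a) (-a) 0 := by
      simpa using ((hasDerivAt_id (0 : ℝ)).smul_const a).const_sub z
    have h3 := (h1.comp_hasDerivAt (0 : ℝ) h2).add
      ((hasDerivAt_id (0 : ℝ)).mul_const b)
    have h4 := hasDerivAt_setIntegral_Iio (hslice_cont z) (hslice z)
      (φ (z - (0 : ℝ) • a) + 0 * b)
    have h5 := HasDerivAt.comp (0 : ℝ) h4 h3
    refine h5.congr_deriv ?_
    simp only [zero_smul, sub_zero, zero_mul, add_zero, map_neg, one_mul]
    ring

/-! ### Graph charts: boundary, normal and surface measure -/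

section Chart

variable {d : ℕ} {V : Type*} [NormedAddCommGroup V] [InnerProductSpace ℝ V]

/-- The region below the graph of `φ`, in the orthogonal coordinates `Θ`. -/
def subgraph (Θ : WithLp 2 (V × ℝ) ≃ₗᵢ[ℝ] Space d) (φ : V → ℝ) : Set (Space d) :=
  {y | (Θ.symm y).snd < φ (Θ.symm y).fst}

/-- The point of the graph of `φ` above `z`, in the orthogonal coordinates `Θ`. -/
def graphPoint (Θ : WithLp 2 (V × ℝ) ≃ₗᵢ[ℝ] Space d) (φ : V → ℝ) (z : V) : Space d :=
  Θ (WithLp.toLp 2 (z, φ z))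

/-- The unit normal `(-∇φ, 1) / √(1 + |∇φ|²)` of the graph of `φ`, extended to the whole space
along the vertical direction. -/
def graphNormal [CompleteSpace V] (Θ : WithLp 2 (V × ℝ) ≃ₗᵢ[ℝ] Space d) (φ : V → ℝ)
    (y : Space d) : Space d :=
  (graphJacobian φ (Θ.symm y).fst)⁻¹ • Θ (WithLp.toLp 2 (-gradient φ (Θ.symm y).fst, 1))

variable (Θ : WithLp 2 (V × ℝ) ≃ₗᵢ[ℝ] Space d) {φ : V → ℝ}

theorem symm_graphPoint (z : V) : Θ.symm (graphPoint Θ φ z) = WithLp.toLp 2 (z, φ z) := by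
  simp [graphPoint]

theorem isGraphParam_graphPoint : IsGraphParam φ (graphPoint Θ φ) := fun x y => by
  rw [graphPoint, graphPoint, Θ.dist_map, dist_eq_norm, WithLp.prod_norm_eq_of_L2]
  simp

theorem mem_subgraph {y : Space d} :
    y ∈ subgraph Θ φ ↔ (Θ.symm y).snd < φ (Θ.symm y).fst := Iff.rfl

theorem isOpen_subgraph (hφ : Continuous φ) : IsOpen (subgraph Θ φ) :=
  isOpen_lt (by fun_prop) (by fun_prop)

theorem frontier_subgraph (hφ : Continuous φ) :
    frontier (subgraph Θ φ) = range (graphPoint Θ φ) := by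
  have hcl : IsClosed {y : Space d | (Θ.symm y).snd ≤ φ (Θ.symm y).fst} :=
    isClosed_le (by fun_prop) (by fun_prop)
  rw [frontier, (isOpen_subgraph Θ hφ).interior_eq]
  ext y
  constructor
  · rintro ⟨h1, h2⟩
    have h3 : (Θ.symm y).snd ≤ φ (Θ.symm y).fst :=
      hcl.closure_subset_iff.2 (fun x hx => ((mem_subgraph Θ).1 hx).le) h1
    have h4 := le_antisymm h3 (not_lt.1 h2)
    refine ⟨(Θ.symm y).fst, ?_⟩
    rw [graphPoint, ← h4]
    exact Θ.apply_symm_apply y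
  · rintro ⟨z, rfl⟩
    refine ⟨?_, ?_⟩
    · have ht : Tendsto (fun t : ℝ => Θ (WithLp.toLp 2 (z, φ z - t))) (𝓝[>] 0)
          (𝓝 (graphPoint Θ φ z)) := by
        have : Continuous fun t : ℝ => Θ (WithLp.toLp 2 (z, φ z - t)) := by fun_prop
        have h := this.tendsto 0
        simp only [sub_zero] at h
        exact h.mono_left nhdsWithin_le_nhds
      refine mem_closure_of_tendsto ht ?_
      filter_upwards [self_mem_nhdsWithin] with t ht
      rw [mem_subgraph, LinearIsometryEquiv.symm_apply_apply]
      exact sub_lt_self _ ht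
    · rw [mem_subgraph, symm_graphPoint]
      exact lt_irrefl _

theorem inner_graphNormal [CompleteSpace V] (y h : Space d) :
    inner ℝ (graphNormal Θ φ y) h = (graphJacobian φ (Θ.symm y).fst)⁻¹ *
      ((Θ.symm h).snd - fderiv ℝ φ (Θ.symm y).fst (Θ.symm h).fst) := by
  rw [graphNormal, real_inner_smul_left]
  congr 1
  conv_lhs => rw [← Θ.apply_symm_apply h]
  rw [Θ.inner_map_map, WithLp.prod_inner_apply]
  simp only [inner_neg_left, gradient]
  rw [InnerProductSpace.toDual_symm_apply]
  simp
  ring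

theorem norm_graphNormal [CompleteSpace V] (y : Space d) : ‖graphNormal Θ φ y‖ = 1 := by
  rw [graphNormal, norm_smul, Θ.norm_map, WithLp.prod_norm_eq_of_L2]
  have h1 : ‖gradient φ (Θ.symm y).fst‖ = ‖fderiv ℝ φ (Θ.symm y).fst‖ := by simp [gradient]
  have h2 : 1 ≤ graphJacobian φ (Θ.symm y).fst := one_le_sqrt_one_add_sq _
  have h3 : √(‖-gradient φ (Θ.symm y).fst‖ ^ 2 + ‖(1 : ℝ)‖ ^ 2) =
      graphJacobian φ (Θ.symm y).fst := by
    rw [norm_neg, h1, norm_one, one_pow, add_comm, graphJacobian]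
  rw [norm_inv, Real.norm_eq_abs, abs_of_nonneg (by linarith)]
  refine (congrArg _ h3).trans ?_
  exact inv_mul_cancel₀ (by linarith)

/-- The graph has an outer unit normal above every point of differentiability. -/
theorem isOuterUnitNormal_subgraph [CompleteSpace V] {z : V} (hz : DifferentiableAt ℝ φ z) :
    IsOuterUnitNormal (subgraph Θ φ) (graphPoint Θ φ z)
      (graphNormal Θ φ (graphPoint Θ φ z)) := by
  refine ⟨norm_graphNormal Θ _, fun δ hδ => ?_⟩
  have hlit := (hasFDerivAt_iff_isLittleO_nhds_zero.1 hz.hasFDerivAt).bound hδ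
  obtain ⟨r, hr, hball⟩ := Metric.eventually_nhds_iff.1 hlit
  refine ⟨r, hr, fun y hy => ?_⟩
  set x := graphPoint Θ φ z with hx
  set h := Θ.symm (y - x) with hh
  have hhn : ‖h‖ = ‖y - x‖ := Θ.symm.norm_map _
  have hfst : ‖h.fst‖ ≤ ‖y - x‖ := by
    rw [← hhn, WithLp.prod_norm_eq_of_L2]
    exact Real.le_sqrt_of_sq_le (by nlinarith [sq_nonneg ‖h.snd‖])
  have hyh : Θ.symm y = WithLp.toLp 2 (z, φ z) + h := by
    rw [hh, map_sub, hx, symm_graphPoint, add_sub_cancel]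
  have hb := hball (y := h.fst) (by
    rw [dist_zero_right]; exact hfst.trans_lt (by rwa [mem_ball_iff_norm] at hy))
  rw [Real.norm_eq_abs] at hb
  have hb' : |φ (z + h.fst) - φ z - fderiv ℝ φ z h.fst| ≤ δ * ‖y - x‖ :=
    hb.trans (mul_le_mul_of_nonneg_left hfst hδ.le)
  have hmem : y ∈ subgraph Θ φ ↔ φ z + h.snd < φ (z + h.fst) := by
    rw [mem_subgraph, hyh]; rfl
  have hJ : 1 ≤ graphJacobian φ z := one_le_sqrt_one_add_sq _
  have hin : inner ℝ (graphNormal Θ φ x) (y - x) =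
      (graphJacobian φ z)⁻¹ * (h.snd - fderiv ℝ φ z h.fst) := by
    rw [inner_graphNormal, hh, hx, symm_graphPoint]
    rfl
  have hJi : h.snd - fderiv ℝ φ z h.fst =
      graphJacobian φ z * inner ℝ (graphNormal Θ φ x) (y - x) := by
    rw [hin, mul_inv_cancel_left₀ (by linarith)]
  have hδn : 0 ≤ δ * ‖y - x‖ := by positivity
  rw [abs_le] at hb'
  rw [hmem]
  constructor
  · intro hlt
    nlinarith
  · intro hlt
    rw [not_lt]
    nlinarith

theorem measurable_graphNormal [CompleteSpace V] [MeasurableSpace V] [BorelSpace V] :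
    Measurable (graphNormal Θ φ) := by
  have h1 : Measurable fun y : Space d => (Θ.symm y).fst :=
    Continuous.measurable (by fun_prop)
  have h2 : Measurable (gradient φ) :=
    (InnerProductSpace.toDual ℝ V).symm.continuous.measurable.comp (measurable_fderiv ℝ φ)
  have h3 : Continuous fun w : V => Θ (WithLp.toLp 2 (-w, (1 : ℝ))) := by fun_prop
  exact (((measurable_graphJacobian φ).comp h1).inv).smul (h3.measurable.comp (h2.comp h1))

variable [FiniteDimensional ℝ V] [MeasurableSpace V] [BorelSpace V]

theorem measurePreserving_graphCoordinates :
    MeasurePreserving (fun p : V × ℝ => Θ (WithLp.toLp 2 p)) :=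
  Θ.measurePreserving.comp (WithLp.volume_preserving_toLp V ℝ)

theorem ae_isOuterUnitNormal_subgraph [CompleteSpace V] {L : NNReal} (hφ : LipschitzWith L φ) :
    ∀ᵐ x ∂(Measure.euclideanHausdorffMeasure (Module.finrank ℝ V)).restrict
        (frontier (subgraph Θ φ)),
      IsOuterUnitNormal (subgraph Θ φ) x (graphNormal Θ φ x) := by
  have hP := isGraphParam_graphPoint Θ (φ := φ)
  rw [frontier_subgraph Θ hφ.continuous, hP.restrict_range_eq_map hφ,
    (hP.isClosedEmbedding hφ).measurableEmbedding.ae_map_iff]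
  refine (withDensity_absolutelyContinuous _ _).ae_le ?_
  filter_upwards [hφ.ae_differentiableAt (μ := (volume : Measure V))] with z hz
  exact isOuterUnitNormal_subgraph Θ hz

theorem euclideanHausdorffMeasure_frontier_subgraph_lt_top {L : NNReal} (hφ : LipschitzWith L φ)
    {B : Set (Space d)} (hB : Bornology.IsBounded B) :
    Measure.euclideanHausdorffMeasure (Module.finrank ℝ V) (frontier (subgraph Θ φ) ∩ B) < ⊤ := by
  have hprop : ProperSpace V := FiniteDimensional.proper ℝ V
  have hP := isGraphParam_graphPoint Θ (φ := φ)
  have himage : frontier (subgraph Θ φ) ∩ B = graphPoint Θ φ '' (graphPoint Θ φ ⁻¹' B) := by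
    rw [image_preimage_eq_range_inter, frontier_subgraph Θ hφ.continuous]
  have hbdd : Bornology.IsBounded (graphPoint Θ φ ⁻¹' B) := by
    obtain ⟨C, hC⟩ := Metric.isBounded_iff.1 hB
    refine Metric.isBounded_iff.2 ⟨C, fun x hx y hy => ?_⟩
    rw [dist_eq_norm]
    exact (hP.norm_sub_le x y).trans (hC hx hy)
  have h := euclideanHausdorffMeasure_image_le_of_dist_le (f := graphPoint Θ φ) (g := (id : V → V))
    (s := graphPoint Θ φ ⁻¹' B) (K := 1 + L) (Module.finrank ℝ V)
    fun x _ y _ => (hP.lipschitz hφ).dist_le_mul x y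
  rw [image_id, InnerProductSpace.euclideanHausdorffMeasure_eq_volume, ← himage] at h
  exact h.trans_lt (ENNReal.mul_lt_top (by finiteness) hbdd.measure_lt_top)

/-- **Divergence theorem below a Lipschitz graph**, for the derivative in direction `v` of a
compactly supported function. -/
theorem integral_fderiv_subgraph_eq [CompleteSpace V] {L : NNReal} (hφ : LipschitzWith L φ)
    {g : Space d → ℝ} (hg : ContDiff ℝ 1 g) (hgc : HasCompactSupport g) (v : Space d) :
    ∫ y in subgraph Θ φ, fderiv ℝ g y v =
      ∫ x in frontier (subgraph Θ φ), g x * inner ℝ (graphNormal Θ φ x) v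
        ∂(Measure.euclideanHausdorffMeasure (Module.finrank ℝ V)) := by
  have hP := isGraphParam_graphPoint Θ (φ := φ)
  set Ψ : (V × ℝ) ≃L[ℝ] Space d :=
    (WithLp.prodContinuousLinearEquiv 2 ℝ V ℝ).symm.trans Θ.toContinuousLinearEquiv with hΨ
  have hΨa : ∀ p, Ψ p = Θ (WithLp.toLp 2 p) := fun p => rfl
  have hΨm : MeasurePreserving Ψ := measurePreserving_graphCoordinates Θ
  have hG : ContDiff ℝ 1 (g ∘ Ψ) := hg.comp Ψ.contDiff
  have hGc : HasCompactSupport (g ∘ Ψ) := hgc.comp_homeomorph Ψ.toHomeomorph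
  have h1 := integral_fderiv_subgraph hφ hG hGc (Θ.symm v).fst (Θ.symm v).snd
  have h2 : ∫ y in subgraph Θ φ, fderiv ℝ g y v =
      ∫ p in {p : V × ℝ | p.2 < φ p.1}, fderiv ℝ (g ∘ Ψ) p ((Θ.symm v).fst, (Θ.symm v).snd) := by
    rw [← hΨm.setIntegral_preimage_emb Ψ.toHomeomorph.measurableEmbedding]
    have hpre : Ψ ⁻¹' subgraph Θ φ = {p : V × ℝ | p.2 < φ p.1} := by
      ext p
      rw [mem_preimage, mem_subgraph, hΨa, LinearIsometryEquiv.symm_apply_apply]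
      rfl
    rw [hpre]
    congr 1
    ext p
    rw [Ψ.comp_right_fderiv]
    have : Ψ ((Θ.symm v).fst, (Θ.symm v).snd) = v := by
      rw [hΨa]; exact Θ.apply_symm_apply v
    rw [ContinuousLinearMap.comp_apply, ContinuousLinearEquiv.coe_coe, this]
  rw [h2, h1, frontier_subgraph Θ hφ.continuous, hP.restrict_range_eq_map hφ,
    (hP.isClosedEmbedding hφ).measurableEmbedding.integral_map,
    integral_withDensity_eq_integral_toReal_smul (measurable_graphJacobian φ).ennreal_ofReal
      (Eventually.of_forall fun _ => ENNReal.ofReal_lt_top)]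
  congr 1
  ext z
  have hJ : 1 ≤ graphJacobian φ z := one_le_sqrt_one_add_sq _
  rw [ENNReal.toReal_ofReal (by linarith), inner_graphNormal, symm_graphPoint]
  have hz : (WithLp.toLp 2 (z, φ z) : WithLp 2 (V × ℝ)).fst = z := rfl
  simp only [Function.comp_apply, hΨa, smul_eq_mul, graphPoint, hz]
  field_simp

end Chart

/-! ### The divergence theorem on a bounded Lipschitz domain -/

section Local

variable {d : ℕ}

/-- Orthogonal coordinates with a prescribed vertical direction. -/
theorem exists_graphCoordinates (e : Space d) (he : ‖e‖ = 1) :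
    ∃ Θ : WithLp 2 ((ℝ ∙ e)ᗮ × ℝ) ≃ₗᵢ[ℝ] Space d, ∀ y : Space d,
      (Θ.symm y).snd = inner ℝ e y ∧
        ((Θ.symm y).fst : Space d) = y - (inner ℝ e y : ℝ) • e := by
  have hee : inner ℝ e e = (1 : ℝ) := by rw [real_inner_self_eq_norm_sq, he, one_pow]
  have hez : ∀ z : (ℝ ∙ e)ᗮ, inner ℝ e (z : Space d) = (0 : ℝ) := fun z =>
    Submodule.mem_orthogonal_singleton_iff_inner_right.1 z.2
  have hmem : ∀ y : Space d, y - (inner ℝ e y : ℝ) • e ∈ (ℝ ∙ e)ᗮ := fun y => by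
    rw [Submodule.mem_orthogonal_singleton_iff_inner_right, inner_sub_right, inner_smul_right, hee]
    ring
  refine ⟨{ toFun := fun p => (p.fst : Space d) + p.snd • e
            invFun := fun y => WithLp.toLp 2 (⟨_, hmem y⟩, inner ℝ e y)
            map_add' := fun p q => ?_
            map_smul' := fun a p => ?_
            left_inv := fun p => ?_
            right_inv := fun y => ?_
            norm_map' := fun p => ?_ }, fun y => ⟨rfl, rfl⟩⟩
  · simp only [WithLp.add_fst, WithLp.add_snd, Submodule.coe_add, add_smul]
    abel
  · simp [smul_smul]
  · have h1 : inner ℝ e ((p.fst : Space d) + p.snd • e) = p.snd := by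
      rw [inner_add_right, hez, inner_smul_right, hee]; ring
    have h2 : (⟨_, hmem ((p.fst : Space d) + p.snd • e)⟩ : (ℝ ∙ e)ᗮ) = p.fst := by
      ext1
      simp only [h1, add_sub_cancel_right]
    exact congrArg (WithLp.toLp 2) (Prod.ext h2 h1)
  · simp
  · change ‖(p.fst : Space d) + p.snd • e‖ = ‖p‖
    rw [WithLp.prod_norm_eq_of_L2, ← Real.sqrt_sq (norm_nonneg ((p.fst : Space d) + p.snd • e)),
      norm_add_sq_real, inner_smul_right, real_inner_comm, hez, norm_smul, he]
    congr 1
    simp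

theorem IsOuterUnitNormal.congr {Ω U B : Set (Space d)} {x n : Space d}
    (h : IsOuterUnitNormal U x n) (hB : IsOpen B) (hx : x ∈ B)
    (hUB : ∀ y ∈ B, y ∈ Ω ↔ y ∈ U) : IsOuterUnitNormal Ω x n := by
  refine ⟨h.1, fun δ hδ => ?_⟩
  obtain ⟨r, hr, hrU⟩ := h.2 δ hδ
  obtain ⟨r', hr', hrB⟩ := Metric.isOpen_iff.1 hB x hx
  refine ⟨min r r', lt_min hr hr', fun y hy => ?_⟩
  have hy1 := Metric.ball_subset_ball (min_le_left r r') hy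
  have hy2 := hrB (Metric.ball_subset_ball (min_le_right r r') hy)
  rw [hUB y hy2]
  exact hrU y hy1

/-- Near a boundary point of a set with Lipschitz boundary, the surface measure is finite, the
outer normal exists almost everywhere and depends measurably on the point, and the divergence
theorem holds for functions supported there. -/
theorem HasLipschitzBoundary.exists_ball {Ω : Set (Space d)} (hΩ : HasLipschitzBoundary Ω)
    {x₀ : Space d} (hx₀ : x₀ ∈ frontier Ω) :
    ∃ r > 0, (∃ ν : Space d → Space d, Measurable ν ∧
        ∀ᵐ x ∂(surfaceMeasure Ω).restrict (Metric.ball x₀ r), IsOuterUnitNormal Ω x (ν x)) ∧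
      surfaceMeasure Ω (Metric.ball x₀ r) < ⊤ ∧
      ∀ g : Space d → ℝ, ContDiff ℝ 1 g → HasCompactSupport g → tsupport g ⊆ Metric.ball x₀ r →
        IsOpen Ω → ∀ v : Space d, ∫ x in Ω, fderiv ℝ g x v =
          ∫ x, g x * inner ℝ (outerNormal Ω x) v ∂surfaceMeasure Ω := by
  obtain ⟨e, φ₀, L, r, he, hφ₀, hr, hΩr⟩ := hΩ x₀ hx₀
  obtain ⟨Θ, hΘ⟩ := exists_graphCoordinates e he
  set φ : (ℝ ∙ e)ᗮ → ℝ := fun z => φ₀ z with hφ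
  have hφL : LipschitzWith L φ := fun x y => hφ₀ x y
  have hfin : Module.finrank ℝ (ℝ ∙ e)ᗮ = d - 1 := by
    have h1 := Submodule.finrank_add_finrank_orthogonal (ℝ ∙ e)
    rw [finrank_span_singleton (by rintro rfl; simp at he), finrank_euclideanSpace,
      Fintype.card_fin] at h1
    omega
  set U := subgraph Θ φ with hU
  set B := Metric.ball x₀ r with hB
  have hBo : IsOpen B := Metric.isOpen_ball
  have hUB : ∀ y ∈ B, y ∈ Ω ↔ y ∈ U := fun y hy => by
    rw [hΩr y hy, hU, mem_subgraph, (hΘ y).1]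
    simp only [hφ, (hΘ y).2]
  have hfr : frontier Ω ∩ B = frontier U ∩ B := by
    rw [← frontier_inter_open_inter hBo, ← frontier_inter_open_inter (s := U) hBo]
    congr 2
    ext y
    exact and_congr_left fun hy => hUB y hy
  have hνm : Measurable (graphNormal Θ φ) := measurable_graphNormal Θ
  have hae := ae_isOuterUnitNormal_subgraph Θ hφL
  have hlt := euclideanHausdorffMeasure_frontier_subgraph_lt_top Θ hφL
    (B := B) Metric.isBounded_ball
  have hint := fun g hg hgc v => integral_fderiv_subgraph_eq Θ hφL (g := g) hg hgc v
  rw [hfin] at hae hlt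
  rw [hfin] at hint
  rw [← hU] at hae hlt
  have hrestr : (surfaceMeasure Ω).restrict B =
      (Measure.euclideanHausdorffMeasure (d - 1)).restrict (frontier U ∩ B) := by
    rw [surfaceMeasure, Measure.restrict_restrict measurableSet_ball, inter_comm, hfr]
  have haeΩ : ∀ᵐ x ∂(surfaceMeasure Ω).restrict B, IsOuterUnitNormal Ω x (graphNormal Θ φ x) := by
    have h1 : ∀ᵐ x ∂(surfaceMeasure Ω).restrict B, x ∈ B := ae_restrict_mem measurableSet_ball
    have h2 : ∀ᵐ x ∂(surfaceMeasure Ω).restrict B,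
        IsOuterUnitNormal U x (graphNormal Θ φ x) := by
      rw [hrestr]
      exact ae_mono (Measure.restrict_mono inter_subset_left le_rfl) hae
    filter_upwards [h1, h2] with x hxB hx using hx.congr hBo hxB hUB
  refine ⟨r, hr, ⟨graphNormal Θ φ, hνm, haeΩ⟩, ?_, fun g hg hgc hgB hΩo v => ?_⟩
  · rw [← Measure.restrict_apply_univ, hrestr, Measure.restrict_apply_univ]
    exact hlt
  · have hg0 : ∀ x ∉ B, g x = 0 := fun x hx => image_eq_zero_of_notMem_tsupport fun h => hx (hgB h)
    have hgf0 : ∀ x ∉ B, fderiv ℝ g x v = 0 := fun x hx => by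
      have : fderiv ℝ g x = 0 := by
        by_contra hne
        exact hx (hgB (support_fderiv_subset ℝ hne))
      rw [this]; rfl
    have h1 : ∫ x in Ω, fderiv ℝ g x v = ∫ x in U, fderiv ℝ g x v := by
      rw [← integral_indicator hΩo.measurableSet,
        ← integral_indicator (isOpen_subgraph Θ hφL.continuous).measurableSet]
      congr 1
      ext x
      by_cases hx : x ∈ B
      · by_cases hxU : x ∈ U
        · rw [indicator_of_mem ((hUB x hx).2 hxU), indicator_of_mem hxU]
        · rw [indicator_of_notMem fun h => hxU ((hUB x hx).1 h), indicator_of_notMem hxU]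
      · simp only [indicator, hgf0 x hx, ite_self]
    rw [h1, hint g hg hgc v, surfaceMeasure, ← integral_indicator isClosed_frontier.measurableSet,
      ← integral_indicator isClosed_frontier.measurableSet]
    have haeΩ' := (ae_restrict_iff' measurableSet_ball).1 haeΩ
    rw [surfaceMeasure, ae_restrict_iff' isClosed_frontier.measurableSet] at haeΩ'
    refine integral_congr_ae ?_
    filter_upwards [haeΩ'] with x hx
    by_cases hxB : x ∈ B
    · have hiff : x ∈ frontier U ↔ x ∈ frontier Ω := by
        have := Set.ext_iff.1 hfr x
        simp only [mem_inter_iff, hxB, and_true] at this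
        exact this.symm
      by_cases hxf : x ∈ frontier Ω
      · rw [indicator_of_mem hxf, indicator_of_mem (hiff.2 hxf), (hx hxf hxB).outerNormal_eq]
      · rw [indicator_of_notMem hxf, indicator_of_notMem (fun h => hxf (hiff.1 h))]
    · simp only [indicator, hg0 x hxB, zero_mul, ite_self]

end Local

section Global

variable {d : ℕ} {Ω : Set (Space d)}

/-- Finitely many of the balls of `HasLipschitzBoundary.exists_ball` cover the boundary. -/
theorem exists_finset_cover_frontier (hΩ : HasLipschitzBoundary Ω)
    (hΩb : Bornology.IsBounded Ω) :
    ∃ (t : Finset (Space d)) (r : Space d → ℝ), frontier Ω ⊆ ⋃ x ∈ t, Metric.ball x (r x) ∧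
      ∀ x ∈ t, (∃ ν : Space d → Space d, Measurable ν ∧
          ∀ᵐ y ∂(surfaceMeasure Ω).restrict (Metric.ball x (r x)), IsOuterUnitNormal Ω y (ν y)) ∧
        surfaceMeasure Ω (Metric.ball x (r x)) < ⊤ := by
  have hc : IsCompact (frontier Ω) :=
    hΩb.isCompact_closure.of_isClosed_subset isClosed_frontier frontier_subset_closure
  have := fun x (hx : x ∈ frontier Ω) => hΩ.exists_ball hx
  choose! r hr hν hlt _ using this
  obtain ⟨t, ht, hcov⟩ := hc.elim_nhds_subcover (fun x => Metric.ball x (r x))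
    fun x hx => Metric.ball_mem_nhds x (hr x hx)
  exact ⟨t, r, hcov, fun x hx => ⟨hν x (ht x hx), hlt x (ht x hx)⟩⟩

theorem ae_mem_frontier : ∀ᵐ x ∂surfaceMeasure Ω, x ∈ frontier Ω :=
  ae_restrict_mem isClosed_frontier.measurableSet

theorem isFiniteMeasure_surfaceMeasure (hΩ : HasLipschitzBoundary Ω)
    (hΩb : Bornology.IsBounded Ω) : IsFiniteMeasure (surfaceMeasure Ω) := by
  obtain ⟨t, r, hcov, ht⟩ := exists_finset_cover_frontier hΩ hΩb
  refine ⟨?_⟩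
  calc surfaceMeasure Ω univ ≤ surfaceMeasure Ω (⋃ x ∈ t, Metric.ball x (r x)) :=
        measure_mono_ae (by filter_upwards [ae_mem_frontier] with x hx _ using hcov hx)
    _ ≤ ∑ x ∈ t, surfaceMeasure Ω (Metric.ball x (r x)) := measure_biUnion_finset_le _ _
    _ < ⊤ := ENNReal.sum_lt_top.2 fun x hx => (ht x hx).2

theorem restrict_surfaceMeasure_eq_self {s : Set (Space d)} (hs : frontier Ω ⊆ s) :
    (surfaceMeasure Ω).restrict s = surfaceMeasure Ω := by
  refine Measure.restrict_eq_self_of_ae_mem ?_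
  filter_upwards [ae_mem_frontier] with x hx using hs hx

/-- The outer unit normal exists almost everywhere on a Lipschitz boundary. -/
theorem ae_isOuterUnitNormal (hΩ : HasLipschitzBoundary Ω) (hΩb : Bornology.IsBounded Ω) :
    ∀ᵐ x ∂surfaceMeasure Ω, IsOuterUnitNormal Ω x (outerNormal Ω x) := by
  obtain ⟨t, r, hcov, ht⟩ := exists_finset_cover_frontier hΩ hΩb
  rw [← restrict_surfaceMeasure_eq_self hcov, ae_restrict_biUnion_finset_iff]
  intro x hx
  obtain ⟨ν, -, hν⟩ := (ht x hx).1
  filter_upwards [hν] with y hy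
  rwa [hy.outerNormal_eq]

theorem aestronglyMeasurable_outerNormal (hΩ : HasLipschitzBoundary Ω)
    (hΩb : Bornology.IsBounded Ω) : AEStronglyMeasurable (outerNormal Ω) (surfaceMeasure Ω) := by
  obtain ⟨t, r, hcov, ht⟩ := exists_finset_cover_frontier hΩ hΩb
  rw [← restrict_surfaceMeasure_eq_self hcov, ← Finset.set_biUnion_coe, biUnion_eq_iUnion,
    aestronglyMeasurable_iUnion_iff]
  rintro ⟨x, hx⟩
  obtain ⟨ν, hνm, hν⟩ := (ht x hx).1
  refine hνm.aestronglyMeasurable.congr ?_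
  filter_upwards [hν] with y hy using hy.outerNormal_eq.symm

theorem aestronglyMeasurable_surfaceMeasure {F : Type*} [NormedAddCommGroup F]
    {g : Space d → F} (hg : ContinuousOn g (frontier Ω)) :
    AEStronglyMeasurable g (surfaceMeasure Ω) := by
  rw [surfaceMeasure]
  exact hg.aestronglyMeasurable isClosed_frontier.measurableSet

theorem integrable_surfaceMeasure_mul_inner (hΩ : HasLipschitzBoundary Ω)
    (hΩb : Bornology.IsBounded Ω) {g : Space d → ℝ} (hg : ContinuousOn g (frontier Ω))
    (v : Space d) :
    Integrable (fun x => g x * inner ℝ (outerNormal Ω x) v) (surfaceMeasure Ω) := by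
  have := isFiniteMeasure_surfaceMeasure hΩ hΩb
  have hc : IsCompact (frontier Ω) :=
    hΩb.isCompact_closure.of_isClosed_subset isClosed_frontier frontier_subset_closure
  obtain ⟨C, hC⟩ := hc.exists_bound_of_continuousOn hg
  have hm := (aestronglyMeasurable_outerNormal hΩ hΩb).inner (𝕜 := ℝ)
    (aestronglyMeasurable_const (b := v))
  refine Integrable.of_bound ((aestronglyMeasurable_surfaceMeasure hg).mul hm) (C * ‖v‖) ?_
  filter_upwards [ae_mem_frontier, ae_isOuterUnitNormal hΩ hΩb] with x hx hn
  rw [norm_mul]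
  refine mul_le_mul (hC x hx) ?_ (norm_nonneg _) ((norm_nonneg _).trans (hC x hx))
  exact (norm_inner_le_norm _ _).trans (by rw [hn.1, one_mul])

/-- Every point of the closure has a neighbourhood such that the divergence theorem holds for
functions supported in it. -/
theorem exists_ball_integral_fderiv_eq (hΩo : IsOpen Ω) (hΩ : HasLipschitzBoundary Ω)
    {x₀ : Space d} (hx₀ : x₀ ∈ closure Ω) :
    ∃ r > 0, ∀ g : Space d → ℝ, ContDiff ℝ 1 g → HasCompactSupport g →
      tsupport g ⊆ Metric.ball x₀ r → ∀ v : Space d, ∫ x in Ω, fderiv ℝ g x v =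
          ∫ x, g x * inner ℝ (outerNormal Ω x) v ∂surfaceMeasure Ω := by
  by_cases hx : x₀ ∈ Ω
  · obtain ⟨r, hr, hrΩ⟩ := Metric.isOpen_iff.1 hΩo x₀ hx
    refine ⟨r, hr, fun g hg hgc hgs v => ?_⟩
    have hzero : ∀ x ∉ Ω, g x = 0 := fun x hx =>
      image_eq_zero_of_notMem_tsupport fun h => hx (hrΩ (hgs h))
    have hl : ∫ x in Ω, fderiv ℝ g x v = 0 := by
      have h1 := hasDerivAt_setIntegral_translate (μ := (volume : Measure (Space d))) hg hgc univ v
      simp only [Measure.restrict_univ] at h1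
      simp_rw [fun t : ℝ => integral_add_right_eq_self (μ := (volume : Measure (Space d)))
        g (t • v)] at h1
      rw [(hasDerivAt_const (0 : ℝ) (∫ x, g x)).unique h1]
      refine setIntegral_eq_integral_of_forall_compl_eq_zero fun x hx => ?_
      have : fderiv ℝ g x = 0 := by
        by_contra hne
        exact hx (hrΩ (hgs (support_fderiv_subset ℝ hne)))
      rw [this]; rfl
    rw [hl, eq_comm]
    refine integral_eq_zero_of_ae ?_
    filter_upwards [ae_mem_frontier] with x hx
    rw [hΩo.frontier_eq] at hx
    rw [hzero x hx.2, zero_mul, Pi.zero_apply]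
  · have hxf : x₀ ∈ frontier Ω := by rw [hΩo.frontier_eq]; exact ⟨hx₀, hx⟩
    obtain ⟨r, hr, -, -, h⟩ := hΩ.exists_ball hxf
    exact ⟨r, hr, fun g hg hgc hgs v => h g hg hgc hgs hΩo v⟩

open scoped Manifold in
/-- **Divergence theorem** on a bounded Lipschitz domain, for the derivative in direction `v` of a
function that is continuously differentiable up to the boundary. -/
theorem integral_fderiv_eq_surfaceIntegral (hΩo : IsOpen Ω) (hΩb : Bornology.IsBounded Ω)
    (hΩ : HasLipschitzBoundary Ω) {g : Space d → ℝ} (hg : ∀ x ∈ closure Ω, ContDiffAt ℝ 1 g x)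
    (v : Space d) :
    ∫ x in Ω, fderiv ℝ g x v =
      ∫ x, g x * inner ℝ (outerNormal Ω x) v ∂surfaceMeasure Ω := by
  have hlocal : ∀ x ∈ closure Ω, ∃ r > 0, (∀ y ∈ Metric.ball x r, ContDiffAt ℝ 1 g y) ∧
      ∀ h : Space d → ℝ, ContDiff ℝ 1 h → HasCompactSupport h →
        tsupport h ⊆ Metric.ball x r → ∫ x in Ω, fderiv ℝ h x v =
          ∫ x, h x * inner ℝ (outerNormal Ω x) v ∂surfaceMeasure Ω := fun x hx => by
    obtain ⟨r, hr, h⟩ := exists_ball_integral_fderiv_eq hΩo hΩ hx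
    obtain ⟨r', hr', h'⟩ := Metric.eventually_nhds_iff_ball.1 ((hg x hx).eventually (by simp))
    exact ⟨min r r', lt_min hr hr',
      fun y hy => h' y (Metric.ball_subset_ball (min_le_right _ _) hy),
      fun f hf hfc hfs => h f hf hfc (hfs.trans (Metric.ball_subset_ball (min_le_left _ _))) v⟩
  choose! r hr hgr hdiv using hlocal
  obtain ⟨t, ht, hcov⟩ := hΩb.isCompact_closure.elim_nhds_subcover (fun x => Metric.ball x (r x))
    fun x hx => Metric.ball_mem_nhds x (hr x hx)
  -- The identity is linear in `g`, and `g` is the sum of the functions `f i * g` on `closure Ω`;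
  -- each of them is globally `C¹`, because `g` is so on the ball carrying `f i`.
  obtain ⟨f, hf⟩ := SmoothPartitionOfUnity.exists_isSubordinate 𝓘(ℝ, Space d)
    (isClosed_closure (s := Ω)) (fun i : t => Metric.ball (i : Space d) (r i))
    (fun i => Metric.isOpen_ball) (by
      refine hcov.trans fun x hx => ?_
      simp only [mem_iUnion] at hx ⊢
      obtain ⟨y, hy, hxy⟩ := hx
      exact ⟨⟨y, hy⟩, hxy⟩)
  have hts : ∀ i : t, tsupport (fun x => f i x * g x) ⊆ tsupport (f i) := fun i =>
    closure_mono fun x hx => left_ne_zero_of_mul hx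
  have hfd : ∀ i : t, ContDiff ℝ 1 (fun x => f i x * g x) := fun i => by
    refine (contMDiff_of_tsupport (I := 𝓘(ℝ, Space d)) (I' := 𝓘(ℝ)) fun x hx => ?_).contDiff
    have h1 : ContDiff ℝ 1 (f i) := (f i).contMDiff.contDiff.of_le (by simp)
    exact (h1.contDiffAt.mul (hgr _ (ht i i.2) x (hf i (hts i hx)))).contMDiffAt
  have hfc : ∀ i : t, HasCompactSupport (fun x => f i x * g x) := fun i =>
    Metric.isCompact_of_isClosed_isBounded (isClosed_tsupport _)
      (Metric.isBounded_ball.subset ((hts i).trans (hf i)))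
  have hsum : ∀ x ∈ closure Ω, g x = ∑ i : t, f i x * g x := fun x hx => by
    have h1 := f.sum_eq_one hx
    rw [finsum_eq_sum_of_fintype] at h1
    rw [← Finset.sum_mul, h1, one_mul]
  have hfder : ∀ x ∈ Ω, fderiv ℝ g x v = ∑ i : t, fderiv ℝ (fun x => f i x * g x) x v := by
    intro x hx
    have heq : g =ᶠ[𝓝 x] fun x => ∑ i : t, f i x * g x := by
      filter_upwards [hΩo.mem_nhds hx] with y hy using hsum y (subset_closure hy)
    rw [heq.fderiv_eq, fderiv_fun_sum fun i _ => (hfd i).differentiable one_ne_zero x,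
      sum_apply]
  rw [setIntegral_congr_fun hΩo.measurableSet hfder, integral_finsetSum]
  · rw [Finset.sum_congr rfl fun (i : t) _ =>
      hdiv i (ht i i.2) _ (hfd i) (hfc i) ((hts i).trans (hf i)), ← integral_finsetSum]
    · refine integral_congr_ae ?_
      filter_upwards [ae_mem_frontier] with x hx
      rw [← Finset.sum_mul, ← hsum x (frontier_subset_closure hx)]
    · exact fun i _ =>
        integrable_surfaceMeasure_mul_inner hΩ hΩb (hfd i).continuous.continuousOn v
  · intro i _
    refine (Continuous.integrable_of_hasCompactSupport ?_ ?_).integrableOn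
    · exact ((hfd i).continuous_fderiv one_ne_zero).clm_apply continuous_const
    · exact (hfc i).fderiv_apply (𝕜 := ℝ) v

end Global

/-! ### Smooth functions of time and space -/

section SpaceTime

variable {d : ℕ}

theorem hasDerivAt_uncurry_left {F : Type*} [NormedAddCommGroup F] [NormedSpace ℝ F]
    {f : ℝ → Space d → F} {t : ℝ} {x : Space d}
    (hf : DifferentiableAt ℝ (fun z : ℝ × Space d => f z.1 z.2) (t, x)) :
    HasDerivAt (fun s => f s x)
      (fderiv ℝ (fun z : ℝ × Space d => f z.1 z.2) (t, x) (1, 0)) t := by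
  have h1 : HasDerivAt (fun s : ℝ => (s, x)) ((1 : ℝ), (0 : Space d)) t :=
    (hasDerivAt_id t).prodMk (hasDerivAt_const t x)
  exact hf.hasFDerivAt.comp_hasDerivAt t h1

theorem pd_eq_fderiv_uncurry {f : ℝ → Space d → ℝ} {t : ℝ} {x : Space d}
    (hf : DifferentiableAt ℝ (fun z : ℝ × Space d => f z.1 z.2) (t, x)) (i : Fin d) :
    pd i (f t) x =
      fderiv ℝ (fun z : ℝ × Space d => f z.1 z.2) (t, x) (0, EuclideanSpace.single i 1) := by
  have h1 : HasFDerivAt (fun y : Space d => (t, y)) (ContinuousLinearMap.inr ℝ ℝ (Space d)) x :=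
    hasFDerivAt_prodMk_right t x
  have h2 := HasFDerivAt.comp x hf.hasFDerivAt h1
  rw [pd]
  exact congrArg (fun ℓ : Space d →L[ℝ] ℝ => ℓ (EuclideanSpace.single i 1)) h2.fderiv

theorem ContDiffAt.fderiv_clm_apply_const {E F : Type*} [NormedAddCommGroup E] [NormedSpace ℝ E]
    [NormedAddCommGroup F] [NormedSpace ℝ F] {f : E → F} {x : E} (hf : ContDiffAt ℝ ∞ f x) (w : E) :
    ContDiffAt ℝ ∞ (fun z => fderiv ℝ f z w) x :=
  (hf.fderiv_right (m := ∞) (by simp)).clm_apply contDiffAt_const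

theorem contDiffAt_pd {f : Space d → ℝ} {x : Space d} (hf : ContDiffAt ℝ ∞ f x) (i : Fin d) :
    ContDiffAt ℝ ∞ (pd i f) x :=
  hf.fderiv_clm_apply_const _

variable {I : Set ℝ} {K : Set (Space d)} {F : Type*} [NormedAddCommGroup F] [NormedSpace ℝ F]

theorem eventually_differentiableAt {E : Type*} [NormedAddCommGroup E] [NormedSpace ℝ E]
    {f : E → F} {x : E} (hf : ContDiffAt ℝ ∞ f x) : ∀ᶠ y in 𝓝 x, DifferentiableAt ℝ f y := by
  filter_upwards [(hf.of_le (m := 1) (by simp)).eventually (by simp)] with y hy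
  exact hy.differentiableAt one_ne_zero

theorem SmoothOnSpaceTime.slice {f : ℝ → Space d → F} (hf : SmoothOnSpaceTime I K f) {t : ℝ}
    (ht : t ∈ I) {x : Space d} (hx : x ∈ K) : ContDiffAt ℝ ∞ (f t) x :=
  ContDiffAt.comp (g := fun z : ℝ × Space d => f z.1 z.2) (f := fun y => (t, y)) x (hf t ht x hx)
    (contDiffAt_const.prodMk contDiffAt_id)

theorem SmoothOnSpaceTime.differentiableAt {f : ℝ → Space d → F} (hf : SmoothOnSpaceTime I K f)
    {t : ℝ} (ht : t ∈ I) {x : Space d} (hx : x ∈ K) :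
    DifferentiableAt ℝ (fun z : ℝ × Space d => f z.1 z.2) (t, x) :=
  (hf t ht x hx).differentiableAt (by simp)

theorem SmoothOnSpaceTime.hasDerivAt {f : ℝ → Space d → F} (hf : SmoothOnSpaceTime I K f)
    {t : ℝ} (ht : t ∈ I) {x : Space d} (hx : x ∈ K) :
    HasDerivAt (fun s => f s x) (deriv (fun s => f s x) t) t :=
  (hasDerivAt_uncurry_left (hf.differentiableAt ht hx)).differentiableAt.hasDerivAt

theorem SmoothOnSpaceTime.timeDeriv {f : ℝ → Space d → F} (hf : SmoothOnSpaceTime I K f) :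
    SmoothOnSpaceTime I K fun t x => deriv (fun s => f s x) t := fun t ht x hx => by
  refine ((hf t ht x hx).fderiv_clm_apply_const (1, 0)).congr_of_eventuallyEq ?_
  filter_upwards [eventually_differentiableAt (hf t ht x hx)] with z hz
  exact (hasDerivAt_uncurry_left (t := z.1) (x := z.2) hz).deriv

theorem SmoothOnSpaceTime.pd {f : ℝ → Space d → ℝ} (hf : SmoothOnSpaceTime I K f) (i : Fin d) :
    SmoothOnSpaceTime I K fun t x => pd i (f t) x := fun t ht x hx => by
  refine ((hf t ht x hx).fderiv_clm_apply_const
    (0, EuclideanSpace.single i 1)).congr_of_eventuallyEq ?_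
  filter_upwards [eventually_differentiableAt (hf t ht x hx)] with z hz
  exact pd_eq_fderiv_uncurry (t := z.1) (x := z.2) hz i

/-- Partial derivatives in time and space commute. -/
theorem SmoothOnSpaceTime.deriv_pd_comm {f : ℝ → Space d → ℝ} (hf : SmoothOnSpaceTime I K f)
    {t : ℝ} (ht : t ∈ I) {x : Space d} (hx : x ∈ K) (i : Fin d) :
    deriv (fun s => _root_.pd i (f s) x) t =
      _root_.pd i (fun y => deriv (fun s => f s y) t) x := by
  have hF := hf t ht x hx
  set G : ℝ × Space d → ℝ := fun z => f z.1 z.2 with hG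
  have h1 : (fun z : ℝ × Space d => _root_.pd i (f z.1) z.2) =ᶠ[𝓝 (t, x)]
      fun z => fderiv ℝ G z (0, EuclideanSpace.single i 1) := by
    filter_upwards [eventually_differentiableAt hF] with z hz
    exact pd_eq_fderiv_uncurry (t := z.1) (x := z.2) hz i
  have h2 : (fun z : ℝ × Space d => deriv (fun s => f s z.2) z.1) =ᶠ[𝓝 (t, x)]
      fun z => fderiv ℝ G z (1, 0) := by
    filter_upwards [eventually_differentiableAt hF] with z hz
    exact (hasDerivAt_uncurry_left (t := z.1) (x := z.2) hz).deriv
  have hdG : DifferentiableAt ℝ (fderiv ℝ G) (t, x) :=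
    (hF.fderiv_right (m := ∞) (by simp)).differentiableAt (by simp)
  have hswap : ∀ w w' : ℝ × Space d,
      fderiv ℝ (fun z => fderiv ℝ G z w) (t, x) w' = fderiv ℝ (fderiv ℝ G) (t, x) w' w := by
    intro w w'
    rw [fderiv_clm_apply hdG (differentiableAt_const w)]
    simp
  have hsymm : IsSymmSndFDerivAt ℝ G (t, x) := hF.isSymmSndFDerivAt (by
    rw [minSmoothness_of_isRCLikeNormedField]; exact WithTop.coe_le_coe.2 le_top)
  rw [(hasDerivAt_uncurry_left (hf.pd i |>.differentiableAt ht hx)).deriv,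
    pd_eq_fderiv_uncurry (f := fun t y => deriv (fun s => f s y) t)
      (hf.timeDeriv.differentiableAt ht hx), h1.fderiv_eq, h2.fderiv_eq, hswap, hswap]
  exact hsymm.eq _ _

/-- Differentiation under the integral sign for a function that is smooth on a compact set carrying
the measure. -/
theorem SmoothOnSpaceTime.hasDerivAt_integral {μ : Measure (Space d)} [IsFiniteMeasure μ]
    (hI : IsOpen I) (hK : IsCompact K) (hμ : ∀ᵐ x ∂μ, x ∈ K) {f : ℝ → Space d → ℝ}
    (hf : SmoothOnSpaceTime I K f) {t : ℝ} (ht : t ∈ I) :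
    HasDerivAt (fun s => ∫ x, f s x ∂μ) (∫ x, deriv (fun s => f s x) t ∂μ) t := by
  obtain ⟨r, hr, hrI⟩ := Metric.nhds_basis_closedBall.mem_iff.1 (hI.mem_nhds ht)
  have hmeas : ∀ g : Space d → ℝ, ContinuousOn g K → AEStronglyMeasurable g μ := fun g hg => by
    rw [← Measure.restrict_eq_self_of_ae_mem hμ]
    exact hg.aestronglyMeasurable hK.measurableSet
  have hcont : ∀ g : ℝ → Space d → ℝ, SmoothOnSpaceTime I K g → ∀ s ∈ I, ContinuousOn (g s) K :=
    fun g hg s hs x hx => (hg.slice hs hx).continuousAt.continuousWithinAt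
  have hjoint : ContinuousOn (fun z : ℝ × Space d => deriv (fun s => f s z.2) z.1)
      (Metric.closedBall t r ×ˢ K) := fun z hz =>
    (hf.timeDeriv z.1 (hrI hz.1) z.2 hz.2).continuousAt.continuousWithinAt
  obtain ⟨C, hC⟩ := ((isCompact_closedBall t r).prod hK).exists_bound_of_continuousOn hjoint
  obtain ⟨C', hC'⟩ := hK.exists_bound_of_continuousOn (hcont f hf t ht)
  refine (hasDerivAt_integral_of_dominated_loc_of_deriv_le (F := f)
    (F' := fun s x => deriv (fun s => f s x) s) (bound := fun _ => C)
    (Metric.ball_mem_nhds t hr) ?_ ?_ ?_ ?_ (integrable_const C) ?_).2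
  · filter_upwards [hI.mem_nhds ht] with s hs using hmeas _ (hcont f hf s hs)
  · refine Integrable.of_bound (hmeas _ (hcont f hf t ht)) C' ?_
    filter_upwards [hμ] with x hx using hC' x hx
  · exact hmeas _ (hcont _ hf.timeDeriv t ht)
  · filter_upwards [hμ] with x hx s hs using hC (s, x) ⟨Metric.ball_subset_closedBall hs, hx⟩
  · filter_upwards [hμ] with x hx s hs
    exact hf.hasDerivAt (hrI (Metric.ball_subset_closedBall hs)) hx

end SpaceTime

/-! ### Calculus of partial derivatives -/

section PartialDerivatives

variable {d : ℕ} {f g : Space d → ℝ} {x : Space d} (i : Fin d)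

theorem pd_add (hf : DifferentiableAt ℝ f x) (hg : DifferentiableAt ℝ g x) :
    pd i (fun y => f y + g y) x = pd i f x + pd i g x := by
  rw [pd, fderiv_fun_add hf hg]; rfl

theorem pd_sub (hf : DifferentiableAt ℝ f x) (hg : DifferentiableAt ℝ g x) :
    pd i (fun y => f y - g y) x = pd i f x - pd i g x := by
  rw [pd, fderiv_fun_sub hf hg]; rfl

theorem pd_mul (hf : DifferentiableAt ℝ f x) (hg : DifferentiableAt ℝ g x) :
    pd i (fun y => f y * g y) x = pd i f x * g x + f x * pd i g x := by
  rw [pd, fderiv_fun_mul hf hg]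
  simp only [_root_.add_apply, _root_.smul_apply, smul_eq_mul, pd]
  ring

theorem pd_const_mul (a : ℝ) (hf : DifferentiableAt ℝ f x) :
    pd i (fun y => a * f y) x = a * pd i f x := by
  rw [pd, fderiv_const_mul hf]; rfl

theorem pd_sum {ι : Type*} {s : Finset ι} {f : ι → Space d → ℝ}
    (hf : ∀ j ∈ s, DifferentiableAt ℝ (f j) x) :
    pd i (fun y => ∑ j ∈ s, f j y) x = ∑ j ∈ s, pd i (f j) x := by
  rw [pd, fderiv_fun_sum hf, _root_.sum_apply]; rfl

theorem pd_comp {h : ℝ → ℝ} (hh : DifferentiableAt ℝ h (f x)) (hf : DifferentiableAt ℝ f x) :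
    pd i (fun y => h (f y)) x = deriv h (f x) * pd i f x := by
  have := hh.hasDerivAt.comp_hasFDerivAt x hf.hasFDerivAt
  rw [pd, show (fun y => h (f y)) = h ∘ f from rfl, this.fderiv]
  rfl

theorem gradient_apply : gradient f x i = pd i f x := by
  have h1 : inner ℝ (gradient f x) (EuclideanSpace.single i (1 : ℝ)) = pd i f x := by
    rw [gradient, InnerProductSpace.toDual_symm_apply]; rfl
  rw [← h1, EuclideanSpace.inner_single_right]
  simp

theorem inner_eq_sum (v w : Space d) : (inner ℝ v w : ℝ) = ∑ i, v i * w i := by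
  rw [PiLp.inner_apply]
  refine Finset.sum_congr rfl fun i _ => ?_
  simp [mul_comm]

theorem norm_sq_eq_sum (v : Space d) : ‖v‖ ^ 2 = ∑ i, v i ^ 2 := by
  rw [EuclideanSpace.norm_sq_eq]
  simp

theorem norm_gradient_sq (f : Space d → ℝ) (x : Space d) :
    ‖gradient f x‖ ^ 2 = ∑ i, pd i f x ^ 2 := by
  simp only [norm_sq_eq_sum, gradient_apply]

/-- `∇ · (a ∇f)` in coordinates. -/
theorem divergence_smul_gradient (a : Space d → ℝ) :
    divergence (fun y => a y • gradient f y) x = ∑ i, pd i (fun y => a y * pd i f y) x := by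
  refine Finset.sum_congr rfl fun i _ => ?_
  congr 1
  ext y
  rw [PiLp.smul_apply, gradient_apply, smul_eq_mul]

end PartialDerivatives

/-! ### Constitutive relations -/

namespace FluidParams

variable (P : FluidParams)

theorem contDiff_specificVolume : ContDiff ℝ ∞ P.specificVolume := by
  unfold specificVolume; fun_prop

theorem contDiff_fluidity : ContDiff ℝ ∞ P.fluidity := by
  unfold fluidity; fun_prop

theorem contDiffAt_ρ {a : ℝ} (ha : 0 < P.specificVolume a) : ContDiffAt ℝ ∞ P.ρ a :=
  contDiffAt_const.div P.contDiff_specificVolume.contDiffAt ha.ne'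

theorem contDiffAt_η {a : ℝ} (ha : 0 < P.fluidity a) : ContDiffAt ℝ ∞ P.η a :=
  contDiffAt_const.div P.contDiff_fluidity.contDiffAt ha.ne'

theorem contDiff_fw : ContDiff ℝ ∞ P.fw := by
  unfold fw; fun_prop

theorem ρ_pos {a : ℝ} (ha : 0 < P.specificVolume a) : 0 < P.ρ a := one_div_pos.2 ha

/-- The specific volume is affine in `c` with slope `α`. -/
theorem deriv_ρ {a : ℝ} (ha : 0 < P.specificVolume a) : deriv P.ρ a = -(P.α * P.ρ a ^ 2) := by
  have h1 : HasDerivAt P.specificVolume P.α a := by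
    have h2 : HasDerivAt (fun c : ℝ => c / P.ρ₁ + (1 - c) / P.ρ₂) (1 / P.ρ₁ + -1 / P.ρ₂) a :=
      ((hasDerivAt_id a).div_const _).add (((hasDerivAt_id a).const_sub 1).div_const _)
    refine h2.congr_deriv ?_
    have := P.ρ₁_pos.ne'
    have := P.ρ₂_pos.ne'
    rw [α]
    field_simp
    ring
  have h3 := h1.fun_inv ha.ne'
  have h4 : P.ρ = fun c => (P.specificVolume c)⁻¹ := by
    ext c; rw [ρ, one_div]
  rw [h4, h3.deriv]
  field_simp

end FluidParams

theorem contDiff_doubleWell : ContDiff ℝ ∞ doubleWell := by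
  unfold doubleWell; fun_prop

theorem mixingEnergy_eq_sum {d : ℕ} (P : FluidParams) (c : Space d → ℝ) (x : Space d) :
    mixingEnergy P c x = 1 / P.ε * doubleWell (c x) + P.ε / 2 * ∑ i, pd i c x ^ 2 := by
  rw [mixingEnergy, norm_gradient_sq]

/-! ### Local balance laws -/

section Balance

variable {d : ℕ} {x : Space d}

/-- Local balance of kinetic energy: with the continuity equation, the rate of change of
`r |u|² / 2` is the power of the acceleration minus the divergence of the convective flux. -/
theorem kinetic_balance {r : Space d → ℝ} {u : Fin d → Space d → ℝ}
    (hr : DifferentiableAt ℝ r x) (hu : ∀ j, DifferentiableAt ℝ (u j) x) {rt : ℝ} {ut : Fin d → ℝ}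
    (hcont : rt + ∑ i, u i x * pd i r x = -(r x * ∑ i, pd i (u i) x)) :
    rt * (∑ j, u j x ^ 2) / 2 + r x * ∑ j, u j x * ut j =
      ∑ j, u j x * (r x * (ut j + ∑ i, u i x * pd i (u j) x))
        - ∑ i, pd i (fun y => r y * (∑ j, u j y * u j y) * u i y) x / 2 := by
  have hpd : ∀ i, pd i (fun y => r y * (∑ j, u j y * u j y) * u i y) x =
      (u i x * pd i r x) * (∑ j, u j x * u j x)
        + 2 * r x * (∑ j, u j x * (u i x * pd i (u j) x))
        + r x * (∑ j, u j x * u j x) * pd i (u i) x := fun i => by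
    have hs : DifferentiableAt ℝ (fun y => ∑ j, u j y * u j y) x :=
      DifferentiableAt.fun_sum fun j _ => (hu j).fun_mul (hu j)
    rw [pd_mul i (hr.fun_mul hs) (hu i), pd_mul i hr hs,
      pd_sum i fun j _ => (hu j).fun_mul (hu j)]
    have : ∑ j, pd i (fun y => u j y * u j y) x = 2 * ∑ j, u j x * pd i (u j) x := by
      rw [Finset.mul_sum]
      refine Finset.sum_congr rfl fun j _ => ?_
      rw [pd_mul i (hu j) (hu j)]; ring
    rw [this]
    have h2 : ∑ j, u j x * (u i x * pd i (u j) x) = u i x * ∑ j, u j x * pd i (u j) x := by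
      rw [Finset.mul_sum]
      exact Finset.sum_congr rfl fun j _ => by ring
    rw [h2]
    ring
  have hsum : ∑ i, pd i (fun y => r y * (∑ j, u j y * u j y) * u i y) x =
      (∑ i, u i x * pd i r x) * (∑ j, u j x * u j x)
        + 2 * r x * (∑ j, u j x * ∑ i, u i x * pd i (u j) x)
        + r x * (∑ j, u j x * u j x) * ∑ i, pd i (u i) x := by
    rw [Finset.sum_congr rfl fun i _ => hpd i, Finset.sum_add_distrib, Finset.sum_add_distrib,
      ← Finset.sum_mul, ← Finset.mul_sum, ← Finset.mul_sum, Finset.sum_comm]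
    simp only [Finset.mul_sum]
  have hacc : ∑ j, u j x * (r x * (ut j + ∑ i, u i x * pd i (u j) x)) =
      r x * ∑ j, u j x * ut j + r x * ∑ j, u j x * ∑ i, u i x * pd i (u j) x := by
    rw [Finset.mul_sum, Finset.mul_sum, ← Finset.sum_add_distrib]
    exact Finset.sum_congr rfl fun j _ => by ring
  have hsq : ∑ j, u j x ^ 2 = ∑ j, u j x * u j x := Finset.sum_congr rfl fun j _ => by ring
  rw [← Finset.sum_div, hsum, hacc, hsq]
  have hrt : rt = -(r x * ∑ i, pd i (u i) x) - ∑ i, u i x * pd i r x := by linarith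
  rw [hrt]
  ring

/-- Power of the viscous forces: the divergence of the stress flux minus the dissipation. -/
theorem viscous_balance {A : Fin d → Fin d → Space d → ℝ} {B : Space d → ℝ}
    {u : Fin d → Space d → ℝ} (hA : ∀ i j, DifferentiableAt ℝ (A i j) x)
    (hB : DifferentiableAt ℝ B x) (hu : ∀ j, DifferentiableAt ℝ (u j) x) :
    ∑ j, u j x * (∑ i, pd i (A i j) x - pd j B x) =
      ∑ i, pd i (fun y => ∑ j, A i j y * u j y - B y * u i y) x
        - (∑ i, ∑ j, A i j x * pd i (u j) x - B x * ∑ i, pd i (u i) x) := by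
  have hpd : ∀ i, pd i (fun y => ∑ j, A i j y * u j y - B y * u i y) x =
      ∑ j, u j x * pd i (A i j) x + ∑ j, A i j x * pd i (u j) x - u i x * pd i B x
        - B x * pd i (u i) x := fun i => by
    rw [pd_sub i (DifferentiableAt.fun_sum fun j _ => (hA i j).fun_mul (hu j)) (hB.fun_mul (hu i)),
      pd_sum i fun j _ => (hA i j).fun_mul (hu j), pd_mul i hB (hu i),
      Finset.sum_congr rfl fun j _ => pd_mul i (hA i j) (hu j), Finset.sum_add_distrib,
      Finset.sum_congr rfl fun j _ => mul_comm (pd i (A i j) x) (u j x)]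
    ring
  rw [Finset.sum_congr rfl fun i _ => hpd i, Finset.sum_sub_distrib, Finset.sum_sub_distrib,
    Finset.sum_add_distrib, ← Finset.mul_sum]
  simp only [mul_sub, Finset.sum_sub_distrib, Finset.mul_sum]
  rw [Finset.sum_comm (f := fun j i => u j x * pd i (A i j) x)]
  ring

/-- Divergence of a scalar times a vector field. -/
theorem sum_pd_mul {a : Space d → ℝ} {w : Fin d → Space d → ℝ} (ha : DifferentiableAt ℝ a x)
    (hw : ∀ i, DifferentiableAt ℝ (w i) x) :
    ∑ i, pd i (fun y => a y * w i y) x =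
      a x * ∑ i, pd i (w i) x + ∑ i, pd i a x * w i x := by
  rw [Finset.sum_congr rfl fun i _ => pd_mul i ha (hw i), Finset.sum_add_distrib, Finset.mul_sum,
    add_comm]

/-- Viscous dissipation as a sum of squares. A planar flow is embedded in three-dimensional space,
where the trace-free part of the stress is formed. -/
theorem dissipation_eq_sum_sq (hd : d = 2 ∨ d = 3) (u : Space d → Space d) (e : ℝ) :
    ∑ i, ∑ j, e * (pd i (fun y => u y j) x + pd j (fun y => u y i) x) * pd i (fun y => u y j) x
        - 2 * e / 3 * divergence u x * divergence u x =
      (e * ∑ i : Fin 3, ∑ j ∈ Finset.Ioi i, |velGrad₃ u x i j + velGrad₃ u x j i| ^ 2)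
        + 2 / 3 * (e * ∑ i : Fin 3, ∑ j ∈ Finset.Ioi i,
            |velGrad₃ u x i i - velGrad₃ u x j j| ^ 2) := by
  have h0 : Finset.Ioi (0 : Fin 3) = {1, 2} := by decide
  have h1 : Finset.Ioi (1 : Fin 3) = {2} := by decide
  have h2 : Finset.Ioi (2 : Fin 3) = ∅ := by decide
  simp only [sq_abs]
  rw [Fin.sum_univ_three, Fin.sum_univ_three, h0, h1, h2, Finset.sum_pair (by decide),
    Finset.sum_pair (by decide), Finset.sum_singleton, Finset.sum_singleton, Finset.sum_empty,
    Finset.sum_empty]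
  rcases hd with rfl | rfl
  · simp [velGrad₃, divergence, Fin.sum_univ_two]
    ring
  · simp [velGrad₃, divergence, Fin.sum_univ_three]
    ring

end Balance

/-! ### The energy flux of a solution -/

section Flux

variable {d : ℕ} (P : FluidParams)

/-- The flux of the total energy: convection of kinetic energy, power of the viscous stress, power
of the pressure, capillary transfer `ε ρ ∂ₜc ∇c / β`, and chemical diffusion `μ̃ M ∇μ̃ / β`. The time
derivative of `c` enters as a separate function `ct`. -/
def energyFlux (c ct μbar pbar : Space d → ℝ) (u : Space d → Space d) (i : Fin d)
    (y : Space d) : ℝ :=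
  -(1 / 2) * (P.ρ (c y) * (∑ j, u y j * u y j) * u y i)
    + 1 / P.Re * (∑ j, P.η (c y) * (pd i (fun z => u z j) y + pd j (fun z => u z i) y) * u y j
        - 2 * P.η (c y) / 3 * divergence u y * u y i)
    - 1 / P.β * (pbar y * u y i)
    + P.ε / P.β * (ct y * (P.ρ (c y) * pd i c y))
    + 1 / P.β * (muTilde P μbar pbar y * (P.M (c y) * pd i (muTilde P μbar pbar) y))

variable {P} {c ct μbar pbar : Space d → ℝ} {u : Space d → Space d} {x : Space d}

theorem contDiffAt_component (hu : ContDiffAt ℝ ∞ u x) (j : Fin d) :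
    ContDiffAt ℝ ∞ (fun y => u y j) x :=
  (EuclideanSpace.proj j : Space d →L[ℝ] ℝ).contDiff.contDiffAt.comp x hu

theorem contDiffAt_divergence (hu : ContDiffAt ℝ ∞ u x) : ContDiffAt ℝ ∞ (divergence u) x :=
  ContDiffAt.sum fun i _ => contDiffAt_pd (contDiffAt_component hu i) i

theorem contDiffAt_muTilde (hμ : ContDiffAt ℝ ∞ μbar x) (hp : ContDiffAt ℝ ∞ pbar x) :
    ContDiffAt ℝ ∞ (muTilde P μbar pbar) x :=
  hμ.add (contDiffAt_const.mul hp)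

theorem contDiffAt_shearStress (hη : ContDiffAt ℝ ∞ (fun y => P.η (c y)) x)
    (hu : ContDiffAt ℝ ∞ u x) (i j : Fin d) :
    ContDiffAt ℝ ∞ (fun y => P.η (c y) *
      (pd i (fun z => u z j) y + pd j (fun z => u z i) y)) x :=
  hη.mul ((contDiffAt_pd (contDiffAt_component hu j) i).add
    (contDiffAt_pd (contDiffAt_component hu i) j))

theorem contDiffAt_bulkStress (hη : ContDiffAt ℝ ∞ (fun y => P.η (c y)) x)
    (hu : ContDiffAt ℝ ∞ u x) :
    ContDiffAt ℝ ∞ (fun y => 2 * P.η (c y) / 3 * divergence u y) x :=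
  ((contDiffAt_const.mul hη).div_const 3).mul (contDiffAt_divergence hu)

/-- The energy flux of smooth fields is smooth, and its divergence may be taken term by term. -/
theorem contDiffAt_and_sum_pd_energyFlux (hρ : ContDiffAt ℝ ∞ (fun y => P.ρ (c y)) x)
    (hη : ContDiffAt ℝ ∞ (fun y => P.η (c y)) x) (hM : ContDiffAt ℝ ∞ (fun y => P.M (c y)) x)
    (hc : ContDiffAt ℝ ∞ c x) (hct : ContDiffAt ℝ ∞ ct x) (hμ : ContDiffAt ℝ ∞ μbar x)
    (hp : ContDiffAt ℝ ∞ pbar x) (hu : ContDiffAt ℝ ∞ u x) :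
    (∀ i, ContDiffAt ℝ ∞ (energyFlux P c ct μbar pbar u i) x) ∧
    ∑ i, pd i (energyFlux P c ct μbar pbar u i) x =
      -(1 / 2) * ∑ i, pd i (fun y => P.ρ (c y) * (∑ j, u y j * u y j) * u y i) x
      + 1 / P.Re * ∑ i, pd i (fun y =>
          ∑ j, P.η (c y) * (pd i (fun z => u z j) y + pd j (fun z => u z i) y) * u y j
          - 2 * P.η (c y) / 3 * divergence u y * u y i) x
      - 1 / P.β * ∑ i, pd i (fun y => pbar y * u y i) x
      + P.ε / P.β * ∑ i, pd i (fun y => ct y * (P.ρ (c y) * pd i c y)) x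
      + 1 / P.β * ∑ i, pd i (fun y =>
          muTilde P μbar pbar y * (P.M (c y) * pd i (muTilde P μbar pbar) y)) x := by
  have huj := contDiffAt_component hu
  have hm := contDiffAt_muTilde (P := P) hμ hp
  have hne : (∞ : WithTop ℕ∞) ≠ 0 := by simp
  have h1 : ∀ i, ContDiffAt ℝ ∞ (fun y => P.ρ (c y) * (∑ j, u y j * u y j) * u y i) x := fun i =>
    (hρ.mul (ContDiffAt.sum fun j _ => (huj j).mul (huj j))).mul (huj i)
  have h2 : ∀ i, ContDiffAt ℝ ∞ (fun y =>
      ∑ j, P.η (c y) * (pd i (fun z => u z j) y + pd j (fun z => u z i) y) * u y j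
        - 2 * P.η (c y) / 3 * divergence u y * u y i) x := fun i =>
    (ContDiffAt.sum fun j _ => (contDiffAt_shearStress hη hu i j).mul (huj j)).sub
      ((contDiffAt_bulkStress hη hu).mul (huj i))
  have h3 : ∀ i, ContDiffAt ℝ ∞ (fun y => pbar y * u y i) x := fun i => hp.mul (huj i)
  have h4 : ∀ i, ContDiffAt ℝ ∞ (fun y => ct y * (P.ρ (c y) * pd i c y)) x := fun i =>
    hct.mul (hρ.mul (contDiffAt_pd hc i))
  have h5 : ∀ i, ContDiffAt ℝ ∞ (fun y =>
      muTilde P μbar pbar y * (P.M (c y) * pd i (muTilde P μbar pbar) y)) x := fun i =>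
    hm.mul (hM.mul (contDiffAt_pd hm i))
  have e1 := fun i => (contDiffAt_const (c := -(1 / 2 : ℝ))).mul (h1 i)
  have e2 := fun i => (contDiffAt_const (c := 1 / P.Re)).mul (h2 i)
  have e3 := fun i => (contDiffAt_const (c := 1 / P.β)).mul (h3 i)
  have e4 := fun i => (contDiffAt_const (c := P.ε / P.β)).mul (h4 i)
  have e5 := fun i => (contDiffAt_const (c := 1 / P.β)).mul (h5 i)
  refine ⟨fun i => ((((e1 i).add (e2 i)).sub (e3 i)).add (e4 i)).add (e5 i), ?_⟩
  rw [Finset.mul_sum, Finset.mul_sum, Finset.mul_sum, Finset.mul_sum, Finset.mul_sum,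
    ← Finset.sum_add_distrib, ← Finset.sum_sub_distrib, ← Finset.sum_add_distrib,
    ← Finset.sum_add_distrib]
  refine Finset.sum_congr rfl fun i _ => ?_
  unfold energyFlux
  have d1 := (h1 i).differentiableAt hne
  have d2 := (h2 i).differentiableAt hne
  have d3 := (h3 i).differentiableAt hne
  have d4 := (h4 i).differentiableAt hne
  have d5 := (h5 i).differentiableAt hne
  rw [pd_add i ((((d1.const_mul _).fun_add (d2.const_mul _)).fun_sub (d3.const_mul _)).fun_add
      (d4.const_mul _)) (d5.const_mul _),
    pd_add i (((d1.const_mul _).fun_add (d2.const_mul _)).fun_sub (d3.const_mul _))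
      (d4.const_mul _),
    pd_sub i ((d1.const_mul _).fun_add (d2.const_mul _)) (d3.const_mul _),
    pd_add i (d1.const_mul _) (d2.const_mul _),
    pd_const_mul i _ d1, pd_const_mul i _ d2, pd_const_mul i _ d3, pd_const_mul i _ d4,
    pd_const_mul i _ d5]

end Flux

section Solution

variable {d : ℕ} {P : FluidParams} {Ω : Set (Space d)} {I : Set ℝ} {c μbar : ℝ → Space d → ℝ}
  {u : ℝ → Space d → Space d} {pbar : ℝ → Space d → ℝ}

namespace IsSmoothSolution

theorem smooth_ρ (hsol : IsSmoothSolution P Ω I c μbar u pbar) :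
    SmoothOnSpaceTime I (closure Ω) fun t x => P.ρ (c t x) := fun t ht x hx =>
  ContDiffAt.comp (g := P.ρ) (t, x) (P.contDiffAt_ρ (hsol.density_pos t ht x hx))
    (hsol.smooth_c t ht x hx)

theorem smooth_η (hsol : IsSmoothSolution P Ω I c μbar u pbar) :
    SmoothOnSpaceTime I (closure Ω) fun t x => P.η (c t x) := fun t ht x hx =>
  ContDiffAt.comp (g := P.η) (t, x) (P.contDiffAt_η (hsol.viscosity_pos t ht x hx))
    (hsol.smooth_c t ht x hx)

theorem smooth_M (hsol : IsSmoothSolution P Ω I c μbar u pbar) :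
    SmoothOnSpaceTime I (closure Ω) fun t x => P.M (c t x) := fun t ht x hx =>
  ContDiffAt.comp (g := P.M) (t, x) P.M_smooth.contDiffAt (hsol.smooth_c t ht x hx)

theorem smooth_fw (hsol : IsSmoothSolution P Ω I c μbar u pbar) :
    SmoothOnSpaceTime I (closure Ω) fun t x => P.fw (c t x) := fun t ht x hx =>
  ContDiffAt.comp (g := P.fw) (t, x) P.contDiff_fw.contDiffAt (hsol.smooth_c t ht x hx)

theorem smooth_kineticEnergy (hsol : IsSmoothSolution P Ω I c μbar u pbar) :
    SmoothOnSpaceTime I (closure Ω) fun t x => P.ρ (c t x) * ‖u t x‖ ^ 2 / 2 := fun t ht x hx =>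
  ((hsol.smooth_ρ t ht x hx).mul ((hsol.smooth_u t ht x hx).norm_sq ℝ)).div_const 2

theorem smooth_mixingEnergy (hsol : IsSmoothSolution P Ω I c μbar u pbar) :
    SmoothOnSpaceTime I (closure Ω) fun t x => P.ρ (c t x) * mixingEnergy P (c t) x := by
  intro t ht x hx
  simp only [mixingEnergy_eq_sum]
  refine (hsol.smooth_ρ t ht x hx).mul ((contDiffAt_const.mul ?_).add
    (contDiffAt_const.mul (ContDiffAt.sum fun i _ => ?_)))
  · exact ContDiffAt.comp (g := doubleWell) (t, x) contDiff_doubleWell.contDiffAt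
      (hsol.smooth_c t ht x hx)
  · exact (hsol.smooth_c.pd i t ht x hx).pow 2

variable {t : ℝ} {x : Space d}

theorem hasDerivAt_ρ (hsol : IsSmoothSolution P Ω I c μbar u pbar) (ht : t ∈ I)
    (hx : x ∈ closure Ω) :
    HasDerivAt (fun s => P.ρ (c s x))
      (-(P.α * P.ρ (c t x) ^ 2) * deriv (fun s => c s x) t) t := by
  have hpos := hsol.density_pos t ht x hx
  have h1 : HasDerivAt P.ρ (-(P.α * P.ρ (c t x) ^ 2)) (c t x) := by
    rw [← P.deriv_ρ hpos]
    exact ((P.contDiffAt_ρ hpos).differentiableAt (by simp)).hasDerivAt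
  exact HasDerivAt.comp (h₂ := P.ρ) (h := fun s => c s x) t h1 (hsol.smooth_c.hasDerivAt ht hx)

theorem pd_ρ (hsol : IsSmoothSolution P Ω I c μbar u pbar) (ht : t ∈ I)
    (hx : x ∈ closure Ω) (i : Fin d) :
    pd i (fun y => P.ρ (c t y)) x = -(P.α * P.ρ (c t x) ^ 2) * pd i (c t) x := by
  have hpos := hsol.density_pos t ht x hx
  rw [pd_comp i ((P.contDiffAt_ρ hpos).differentiableAt (by simp))
    ((hsol.smooth_c.slice ht hx).differentiableAt (by simp)), P.deriv_ρ hpos]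

theorem deriv_kineticEnergy (hsol : IsSmoothSolution P Ω I c μbar u pbar) (ht : t ∈ I)
    (hx : x ∈ closure Ω) :
    deriv (fun s => P.ρ (c s x) * ‖u s x‖ ^ 2 / 2) t =
      -(P.α * P.ρ (c t x) ^ 2) * deriv (fun s => c s x) t * (∑ j, u t x j ^ 2) / 2
        + P.ρ (c t x) * ∑ j, u t x j * deriv (fun s => u s x) t j := by
  have h1 := (hsol.smooth_u.hasDerivAt ht hx).norm_sq
  rw [(((hsol.hasDerivAt_ρ ht hx).fun_mul h1).div_const 2).deriv, norm_sq_eq_sum, inner_eq_sum]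
  ring

theorem deriv_mixingEnergy (hsol : IsSmoothSolution P Ω I c μbar u pbar) (ht : t ∈ I)
    (hx : x ∈ closure Ω) :
    deriv (fun s => P.ρ (c s x) * mixingEnergy P (c s) x) t =
      -(P.α * P.ρ (c t x) ^ 2) * deriv (fun s => c s x) t * mixingEnergy P (c t) x
        + P.ρ (c t x) * (1 / P.ε * deriv doubleWell (c t x) * deriv (fun s => c s x) t
          + P.ε * ∑ i, pd i (fun y => deriv (fun s => c s y) t) x * pd i (c t) x) := by
  have h1 : HasDerivAt (fun s => doubleWell (c s x))
      (deriv doubleWell (c t x) * deriv (fun s => c s x) t) t :=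
    ((contDiff_doubleWell.differentiable (by simp) _).hasDerivAt).comp t
      (hsol.smooth_c.hasDerivAt ht hx)
  have h2 : HasDerivAt (fun s => ∑ i, pd i (c s) x ^ 2)
      (∑ i, 2 * pd i (c t) x * pd i (fun y => deriv (fun s => c s y) t) x) t := by
    refine HasDerivAt.fun_sum fun i _ => ?_
    have h := ((hsol.smooth_c.pd i).hasDerivAt ht hx).fun_pow 2
    rw [hsol.smooth_c.deriv_pd_comm ht hx i] at h
    refine h.congr_deriv ?_
    simp
  have h3 := (hsol.hasDerivAt_ρ ht hx).fun_mul
    ((h1.const_mul (1 / P.ε)).fun_add (h2.const_mul (P.ε / 2)))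
  simp only [mixingEnergy_eq_sum]
  rw [h3.deriv]
  have h4 : ∑ i, 2 * pd i (c t) x * pd i (fun y => deriv (fun s => c s y) t) x =
      2 * ∑ i, pd i (fun y => deriv (fun s => c s y) t) x * pd i (c t) x := by
    rw [Finset.mul_sum]
    exact Finset.sum_congr rfl fun i _ => by ring
  rw [h4]
  ring

/-- **Local energy balance**: the rate of change of the energy density is the divergence of the
energy flux minus the viscous and the diffusive dissipation. -/
theorem local_energy_balance (hsol : IsSmoothSolution P Ω I c μbar u pbar) (ht : t ∈ I)
    (hd : d = 2 ∨ d = 3) (hx : x ∈ Ω) :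
    deriv (fun s => P.ρ (c s x) * ‖u s x‖ ^ 2 / 2) t
        + 1 / P.β * deriv (fun s => P.ρ (c s x) * mixingEnergy P (c s) x) t =
      ∑ i, pd i (energyFlux P (c t) (fun y => deriv (fun s => c s y) t) (μbar t) (pbar t)
          (u t) i) x
        - (1 / P.Re * (P.η (c t x) * ∑ i : Fin 3, ∑ j ∈ Finset.Ioi i,
              |velGrad₃ (u t) x i j + velGrad₃ (u t) x j i| ^ 2)
          + 2 / (3 * P.Re) * (P.η (c t x) * ∑ i : Fin 3, ∑ j ∈ Finset.Ioi i,
              |velGrad₃ (u t) x i i - velGrad₃ (u t) x j j| ^ 2)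
          + 1 / P.β * (P.M (c t x) * ‖gradient (muTilde P (μbar t) (pbar t)) x‖ ^ 2)) := by
  have hxc : x ∈ closure Ω := subset_closure hx
  have hne : (∞ : WithTop ℕ∞) ≠ 0 := by simp
  have hc := hsol.smooth_c.slice ht hxc
  have hct := hsol.smooth_c.timeDeriv.slice ht hxc
  have hρ := hsol.smooth_ρ.slice ht hxc
  have hη := hsol.smooth_η.slice ht hxc
  have hM := hsol.smooth_M.slice ht hxc
  have hu := hsol.smooth_u.slice ht hxc
  have hμ := hsol.smooth_μbar.slice ht hxc
  have hp := hsol.smooth_pbar.slice ht hxc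
  have hm := contDiffAt_muTilde (P := P) hμ hp
  have huj := fun j => (contDiffAt_component hu j).differentiableAt hne
  have hρ0 := (P.ρ_pos (hsol.density_pos t ht x hxc)).ne'
  have hRe := P.Re_pos.ne'
  have hβ := P.β_pos.ne'
  have hε := P.ε_pos.ne'
  have hphase := hsol.phase_eq t ht x hx
  have hpot := hsol.potential_eq t ht x hx
  have hmom := hsol.momentum_eq t ht x hx
  have hqi := hsol.quasi_incompressible t ht x hx
  have hflux : divergence (fun y => P.M (c t y) • gradient (μbar t) y) x
      + P.α * divergence (fun y => P.M (c t y) • gradient (pbar t) y) x =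
      ∑ i, pd i (fun y => P.M (c t y) * pd i (muTilde P (μbar t) (pbar t)) y) x := by
    rw [divergence_smul_gradient, divergence_smul_gradient, Finset.mul_sum,
      ← Finset.sum_add_distrib]
    refine Finset.sum_congr rfl fun i _ => ?_
    have d1 := (hM.mul (contDiffAt_pd hμ i)).differentiableAt hne
    have d2 := (hM.mul (contDiffAt_pd hp i)).differentiableAt hne
    rw [← pd_const_mul i P.α d2, ← pd_add i d1 (d2.const_mul _)]
    have heq : (fun y => P.M (c t y) * pd i (muTilde P (μbar t) (pbar t)) y) =ᶠ[𝓝 x]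
        fun y => P.M (c t y) * pd i (μbar t) y + P.α * (P.M (c t y) * pd i (pbar t) y) := by
      filter_upwards [eventually_differentiableAt hμ, eventually_differentiableAt hp] with y h1 h2
      have : pd i (muTilde P (μbar t) (pbar t)) y = pd i (μbar t) y + P.α * pd i (pbar t) y := by
        rw [← pd_const_mul i P.α h2, ← pd_add i h1 (h2.const_mul _)]
        rfl
      rw [this]; ring
    unfold pd at heq ⊢
    rw [heq.fderiv_eq]
  rw [divergence_smul_gradient] at hpot
  rw [hflux, inner_eq_sum] at hphase
  simp only [gradient_apply] at hphase
  have hqi' : divergence (u t) x =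
      P.α * ∑ i, pd i (fun y => P.M (c t y) * pd i (muTilde P (μbar t) (pbar t)) y) x := by
    rw [hqi, ← hflux]; ring
  have hdivu : ∑ i, pd i (fun y => u t y i) x = divergence (u t) x := rfl
  -- `ρ' = -α ρ²` makes the phase equation and the constraint on `∇ · u` the continuity equation
  have hkin := kinetic_balance (r := fun y => P.ρ (c t y)) (u := fun j y => u t y j)
    (rt := -(P.α * P.ρ (c t x) ^ 2) * deriv (fun s => c s x) t)
    (ut := fun j => deriv (fun s => u s x) t j) (hρ.differentiableAt hne) huj (by
      simp only [hsol.pd_ρ ht hxc]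
      rw [hdivu, hqi', ← hphase]
      have : ∑ i, u t x i * (-(P.α * P.ρ (c t x) ^ 2) * pd i (c t) x) =
          -(P.α * P.ρ (c t x) ^ 2) * ∑ i, u t x i * pd i (c t) x := by
        rw [Finset.mul_sum]
        exact Finset.sum_congr rfl fun i _ => by ring
      rw [this]; ring)
  have hvis := viscous_balance (x := x)
    (A := fun i j y => P.η (c t y) * (pd i (fun z => u t z j) y + pd j (fun z => u t z i) y))
    (B := fun y => 2 * P.η (c t y) / 3 * divergence (u t) y) (u := fun j y => u t y j)
    (fun i j => (contDiffAt_shearStress hη hu i j).differentiableAt hne)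
    ((contDiffAt_bulkStress hη hu).differentiableAt hne) huj
  rw [hdivu, dissipation_eq_sum_sq hd] at hvis
  have hpre := sum_pd_mul (x := x) (a := pbar t) (w := fun i y => u t y i)
    (hp.differentiableAt hne) huj
  rw [hdivu] at hpre
  have hcap := sum_pd_mul (x := x) (a := fun y => deriv (fun s => c s y) t)
    (w := fun i y => P.ρ (c t y) * pd i (c t) y) (hct.differentiableAt hne)
    fun i => (hρ.mul (contDiffAt_pd hc i)).differentiableAt hne
  have hchem := sum_pd_mul (x := x) (a := muTilde P (μbar t) (pbar t))
    (w := fun i y => P.M (c t y) * pd i (muTilde P (μbar t) (pbar t)) y)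
    (hm.differentiableAt hne) fun i => (hM.mul (contDiffAt_pd hm i)).differentiableAt hne
  have hcap2 : ∑ i, pd i (fun y => deriv (fun s => c s y) t) x * (P.ρ (c t x) * pd i (c t) x) =
      P.ρ (c t x) * ∑ i, pd i (fun y => deriv (fun s => c s y) t) x * pd i (c t) x := by
    rw [Finset.mul_sum]
    exact Finset.sum_congr rfl fun i _ => by ring
  have hchem2 : ∑ i, pd i (muTilde P (μbar t) (pbar t)) x *
      (P.M (c t x) * pd i (muTilde P (μbar t) (pbar t)) x) =
      P.M (c t x) * ‖gradient (muTilde P (μbar t) (pbar t)) x‖ ^ 2 := by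
    rw [norm_gradient_sq, Finset.mul_sum]
    exact Finset.sum_congr rfl fun i _ => by ring
  rw [hcap2] at hcap
  rw [hchem2] at hchem
  -- the momentum equation, tested with the velocity
  have hX : P.Re * ∑ j, u t x j * (P.ρ (c t x) *
        (deriv (fun s => u s x) t j + ∑ i, u t x i * pd i (fun y => u t y j) x)) =
      ∑ j, u t x j * (∑ i, pd i (fun y => P.η (c t y) *
          (pd i (fun z => u t z j) y + pd j (fun z => u t z i) y)) x
        - pd j (fun y => 2 * P.η (c t y) / 3 * divergence (u t) y) x)
      - P.Re / P.β * ∑ j, pd j (pbar t) x * u t x j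
      + P.Re / P.β * P.ρ (c t x) * μbar t x * ∑ j, u t x j * pd j (c t) x := by
    simp only [Finset.mul_sum]
    rw [← Finset.sum_sub_distrib, ← Finset.sum_add_distrib]
    refine Finset.sum_congr rfl fun j _ => ?_
    linear_combination (u t x j) * hmom j
  have hmt : muTilde P (μbar t) (pbar t) x = μbar t x + P.α * pbar t x := rfl
  rw [hsol.deriv_kineticEnergy ht hxc, hsol.deriv_mixingEnergy ht hxc,
    (contDiffAt_and_sum_pd_energyFlux hρ hη hM hc hct hμ hp hu).2, hkin, hpre, hcap, hchem, hqi',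
    hmt]
  rw [hvis] at hX
  rw [← Finset.sum_div]
  generalize ∑ j, u t x j * (P.ρ (c t x) *
        (deriv (fun s => u s x) t j + ∑ i, u t x i * pd i (fun y => u t y j) x)) = X at *
  generalize ∑ i, pd i (fun y => P.ρ (c t y) * pd i (c t) y) x = Dc at *
  generalize ∑ i, pd i (fun y => P.M (c t y) * pd i (muTilde P (μbar t) (pbar t)) y) x = J at *
  generalize ∑ j, u t x j * pd j (c t) x = Su at *
  generalize ∑ j, pd j (pbar t) x * u t x j = Sp at *
  have hpot' : P.ρ (c t x) * μbar t x = P.ρ (c t x) * (1 / P.ε * deriv doubleWell (c t x))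
      - P.ε * Dc - P.α * P.ρ (c t x) ^ 2 * mixingEnergy P (c t) x := by
    rw [hpot]; field_simp
  have hX' : ∀ a b e : ℝ, P.Re * X = a - (b + 2 / 3 * e) - P.Re / P.β * Sp
      + P.Re / P.β * P.ρ (c t x) * μbar t x * Su →
      X = 1 / P.Re * a - 1 / P.Re * b - 2 / (3 * P.Re) * e - 1 / P.β * Sp
        + 1 / P.β * (P.ρ (c t x) * μbar t x * Su) := by
    intro a b e h
    field_simp at h ⊢
    linear_combination h
  have hX1 := hX' _ _ _ hX
  linear_combination hX1 - 1 / P.β * deriv (fun s => c s x) t * hpot'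
    + 1 / P.β * μbar t x * hphase

end IsSmoothSolution
end Solution

/-! ### Energy balance on the wall and in the whole domain -/

section Wall

variable {d : ℕ} {P : FluidParams} {Ω : Set (Space d)} {I : Set ℝ} {c μbar : ℝ → Space d → ℝ}
  {u : ℝ → Space d → Space d} {pbar : ℝ → Space d → ℝ} {t : ℝ} {x n : Space d}

/-- **Energy balance on the wall**: the outward energy flux and the rate of change of the wall
energy add up to minus the dissipation by contact line motion and by slip. The slip condition is
used with the velocity itself as tangent vector. -/
theorem IsSmoothSolution.wall_energy_balance (hsol : IsSmoothSolution P Ω I c μbar u pbar)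
    (ht : t ∈ I) (hx : x ∈ frontier Ω) (hn : IsOuterUnitNormal Ω x n) :
    ∑ i, energyFlux P (c t) (fun y => deriv (fun s => c s y) t) (μbar t) (pbar t) (u t) i x * n i
        + P.αw / P.β * deriv (fun s => P.fw (c s x)) t =
      -(1 / P.β * P.MΓ (c t x) * |wallPotential P (c t) x n| ^ 2
          + 1 / (P.ls (c t x) * P.Re) * ‖tangential n (u t x)‖ ^ 2) := by
  have hxc := frontier_subset_closure hx
  have hun := hsol.wall_impermeable t ht x hx n hn
  have hnu : inner ℝ n (u t x) = (0 : ℝ) := by rw [real_inner_comm]; exact hun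
  have htan : tangential n (u t x) = u t x := by rw [tangential, hnu, zero_smul, sub_zero]
  have hphase := hsol.wall_phase t ht x hx n hn
  have hflux := hsol.wall_flux t ht x hx n hn
  have hslip := hsol.wall_slip t ht x hx n hn (u t x) hnu
  have hRe := P.Re_pos.ne'
  have hβ := P.β_pos.ne'
  have hls := (hsol.slip_pos t ht x hx).ne'
  have hfw : deriv (fun s => P.fw (c s x)) t =
      deriv P.fw (c t x) * deriv (fun s => c s x) t :=
    (HasDerivAt.comp (h₂ := P.fw) (h := fun s => c s x) t
      ((P.contDiff_fw.differentiable (by simp) _).hasDerivAt)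
      (hsol.smooth_c.hasDerivAt ht hxc)).deriv
  rw [tangential, inner_sub_right, inner_smul_right, hun, mul_zero, sub_zero] at hphase
  rw [htan, real_inner_self_eq_norm_sq] at hslip
  have hsum_n : ∑ i, u t x i * n i = 0 := by rw [← inner_eq_sum]; exact hun
  have hstress : ∑ i, ∑ j, n i * stress P (c t) (pbar t) (u t) x i j * u t x j =
      ∑ i, (∑ j, P.η (c t x) * (pd i (fun z => u t z j) x + pd j (fun z => u t z i) x) * u t x j)
        * n i := by
    have hdiag : ∀ X : ℝ, ∑ i, ∑ j, n i * (if i = j then X else 0) * u t x j = 0 := fun X => by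
      have h1 : ∀ i, ∑ j, n i * (if i = j then X else 0) * u t x j = X * (u t x i * n i) :=
        fun i => by
          rw [Finset.sum_eq_single i (fun j _ hj => by rw [if_neg (Ne.symm hj)]; ring)
            (fun h => absurd (Finset.mem_univ i) h), if_pos rfl]
          ring
      rw [Finset.sum_congr rfl fun i _ => h1 i, ← Finset.mul_sum, hsum_n, mul_zero]
    have hsplit : ∀ i j, n i * stress P (c t) (pbar t) (u t) x i j * u t x j =
        P.η (c t x) * (pd i (fun z => u t z j) x + pd j (fun z => u t z i) x) * u t x j * n i
          + n i * (if i = j then -(2 * P.η (c t x) / 3) * divergence (u t) x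
            - P.Re / P.β * pressure P (c t) (pbar t) x else 0) * u t x j := fun i j => by
      rw [stress]; ring
    simp only [hsplit, Finset.sum_add_distrib]
    rw [hdiag, add_zero]
    exact Finset.sum_congr rfl fun i _ => by rw [Finset.sum_mul]
  rw [hstress] at hslip
  have hdn : ∀ f : Space d → ℝ, inner ℝ n (gradient f x) = ∑ i, pd i f x * n i := fun f => by
    rw [real_inner_comm, inner_eq_sum]
    simp only [gradient_apply]
  rw [hdn] at hflux
  -- Convection, the isotropic stress and the pressure contribute multiples of `u · n = 0`, and
  -- chemical diffusion a multiple of `∂ₙ μ̃ = 0`.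
  have hQ : ∑ i, energyFlux P (c t) (fun y => deriv (fun s => c s y) t) (μbar t) (pbar t) (u t) i x
        * n i =
      1 / P.Re * (∑ i, (∑ j, P.η (c t x) *
          (pd i (fun z => u t z j) x + pd j (fun z => u t z i) x) * u t x j) * n i)
        + P.ε / P.β * (deriv (fun s => c s x) t * (P.ρ (c t x) * ∑ i, pd i (c t) x * n i)) := by
    have h1 : ∀ i, energyFlux P (c t) (fun y => deriv (fun s => c s y) t) (μbar t) (pbar t)
        (u t) i x * n i =
        1 / P.Re * ((∑ j, P.η (c t x) *
          (pd i (fun z => u t z j) x + pd j (fun z => u t z i) x) * u t x j) * n i)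
        + P.ε / P.β * deriv (fun s => c s x) t * P.ρ (c t x) * (pd i (c t) x * n i)
        + 1 / P.β * muTilde P (μbar t) (pbar t) x * P.M (c t x) *
            (pd i (muTilde P (μbar t) (pbar t)) x * n i)
        + (-(1 / 2) * (P.ρ (c t x) * ∑ j, u t x j * u t x j)
            - 1 / P.Re * (2 * P.η (c t x) / 3 * divergence (u t) x)
            - 1 / P.β * pbar t x) * (u t x i * n i) := fun i => by
      rw [energyFlux]; ring
    rw [Finset.sum_congr rfl fun i _ => h1 i, Finset.sum_add_distrib, Finset.sum_add_distrib,
      Finset.sum_add_distrib, ← Finset.mul_sum, ← Finset.mul_sum, ← Finset.mul_sum,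
      ← Finset.mul_sum, hsum_n, hflux]
    ring
  have hL : wallPotential P (c t) x n =
      P.ε * P.ρ (c t x) * (∑ i, pd i (c t) x * n i) + P.αw * deriv P.fw (c t x) := by
    rw [wallPotential, hdn]
  rw [hQ, hfw, htan, sq_abs]
  have hvisc : 1 / P.Re * (∑ i, (∑ j, P.η (c t x) *
          (pd i (fun z => u t z j) x + pd j (fun z => u t z i) x) * u t x j) * n i) =
      1 / P.β * wallPotential P (c t) x n * inner ℝ (u t x) (gradient (c t) x)
        - 1 / (P.ls (c t x) * P.Re) * ‖u t x‖ ^ 2 := by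
    generalize (∑ i, (∑ j, P.η (c t x) *
          (pd i (fun z => u t z j) x + pd j (fun z => u t z i) x) * u t x j) * n i) = Y at *
    field_simp at hslip ⊢
    linear_combination hslip
  rw [hvisc]
  linear_combination (1 / P.β * wallPotential P (c t) x n) * hphase
    - 1 / P.β * deriv (fun s => c s x) t * hL

end Wall

section Integrability

variable {d : ℕ} {Ω : Set (Space d)} {u : Space d → Space d}

theorem integrableOn_of_contDiffAt (hΩb : Bornology.IsBounded Ω) {f : Space d → ℝ}
    (hf : ∀ x ∈ closure Ω, ContDiffAt ℝ ∞ f x) : IntegrableOn f Ω := by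
  have hc : ContinuousOn f (closure Ω) := fun x hx => (hf x hx).continuousAt.continuousWithinAt
  exact (hc.integrableOn_compact hΩb.isCompact_closure).mono_set subset_closure

theorem contDiffAt_velGrad₃ {x : Space d} (hu : ContDiffAt ℝ ∞ u x) (i j : Fin 3) :
    ContDiffAt ℝ ∞ (fun y => velGrad₃ u y i j) x := by
  unfold velGrad₃
  split_ifs with h
  · exact contDiffAt_pd (contDiffAt_component hu _) _
  · exact contDiffAt_const

end Integrability

end

/-! ### The energy law -/

theorem mainTheorem2 {d : ℕ} (hd : d = 2 ∨ d = 3) (P : FluidParams)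
    {Ω : Set (Space d)} (hΩ_open : IsOpen Ω) (hΩ_bdd : Bornology.IsBounded Ω)
    (hΩ_lip : HasLipschitzBoundary Ω) {I : Set ℝ} (hI : IsOpen I)
    (c μbar : ℝ → Space d → ℝ) (u : ℝ → Space d → Space d) (pbar : ℝ → Space d → ℝ)
    (hsol : IsSmoothSolution P Ω I c μbar u pbar) :
    ∀ t ∈ I, HasDerivAt (fun s => totalEnergy P Ω (c s) (u s))
      (-(1 / P.Re * ∫ x in Ω, P.η (c t x) * ∑ i : Fin 3, ∑ j ∈ Finset.Ioi i,
            |velGrad₃ (u t) x i j + velGrad₃ (u t) x j i| ^ 2)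
        - 2 / (3 * P.Re) * (∫ x in Ω, P.η (c t x) * ∑ i : Fin 3, ∑ j ∈ Finset.Ioi i,
            |velGrad₃ (u t) x i i - velGrad₃ (u t) x j j| ^ 2)
        - 1 / P.β * (∫ x in Ω, P.M (c t x) * ‖gradient (muTilde P (μbar t) (pbar t)) x‖ ^ 2)
        - ∫ x, (1 / P.β * P.MΓ (c t x) * |wallPotential P (c t) x (outerNormal Ω x)| ^ 2
            + 1 / (P.ls (c t x) * P.Re) * ‖tangential (outerNormal Ω x) (u t x)‖ ^ 2)
          ∂surfaceMeasure Ω) t := by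
  intro t ht
  have hcl : IsCompact (closure Ω) := hΩ_bdd.isCompact_closure
  have hfin : IsFiniteMeasure (volume.restrict Ω) := ⟨by
    rw [Measure.restrict_apply_univ]; exact hΩ_bdd.measure_lt_top⟩
  have hfinS : IsFiniteMeasure (surfaceMeasure Ω) := isFiniteMeasure_surfaceMeasure hΩ_lip hΩ_bdd
  have hΩae : ∀ᵐ x ∂volume.restrict Ω, x ∈ closure Ω := by
    filter_upwards [ae_restrict_mem hΩ_open.measurableSet] with x hx using subset_closure hx
  have hSae : ∀ᵐ x ∂surfaceMeasure Ω, x ∈ closure Ω := by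
    filter_upwards [ae_mem_frontier] with x hx using frontier_subset_closure hx
  have hkin := hsol.smooth_kineticEnergy
  have hmix := hsol.smooth_mixingEnergy
  have hfw := hsol.smooth_fw
  have hderiv := ((hkin.hasDerivAt_integral hI hcl hΩae ht).add
    ((hmix.hasDerivAt_integral hI hcl hΩae ht).const_mul (1 / P.β))).add
    ((hfw.hasDerivAt_integral hI hcl hSae ht).const_mul (P.αw / P.β))
  refine hderiv.congr_deriv ?_
  set Q := energyFlux P (c t) (fun y => deriv (fun s => c s y) t) (μbar t) (pbar t) (u t) with hQ
  have hQsmooth : ∀ i, ∀ x ∈ closure Ω, ContDiffAt ℝ ∞ (Q i) x := fun i x hx =>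
    (contDiffAt_and_sum_pd_energyFlux (hsol.smooth_ρ.slice ht hx) (hsol.smooth_η.slice ht hx)
      (hsol.smooth_M.slice ht hx) (hsol.smooth_c.slice ht hx)
      (hsol.smooth_c.timeDeriv.slice ht hx) (hsol.smooth_μbar.slice ht hx)
      (hsol.smooth_pbar.slice ht hx) (hsol.smooth_u.slice ht hx)).1 i
  have hvel : ∀ i j, ∀ x ∈ closure Ω, ContDiffAt ℝ ∞ (fun y => velGrad₃ (u t) y i j) x :=
    fun i j x hx => contDiffAt_velGrad₃ (hsol.smooth_u.slice ht hx) i j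
  have hm : ∀ x ∈ closure Ω, ContDiffAt ℝ ∞ (muTilde P (μbar t) (pbar t)) x := fun x hx =>
    contDiffAt_muTilde (hsol.smooth_μbar.slice ht hx) (hsol.smooth_pbar.slice ht hx)
  have i1 : IntegrableOn (fun x => P.η (c t x) * ∑ i : Fin 3, ∑ j ∈ Finset.Ioi i,
      |velGrad₃ (u t) x i j + velGrad₃ (u t) x j i| ^ 2) Ω :=
    integrableOn_of_contDiffAt hΩ_bdd fun x hx => by
      simp only [sq_abs]
      exact (hsol.smooth_η.slice ht hx).mul (ContDiffAt.sum fun i _ => ContDiffAt.sum fun j _ =>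
        ((hvel i j x hx).add (hvel j i x hx)).pow 2)
  have i2 : IntegrableOn (fun x => P.η (c t x) * ∑ i : Fin 3, ∑ j ∈ Finset.Ioi i,
      |velGrad₃ (u t) x i i - velGrad₃ (u t) x j j| ^ 2) Ω :=
    integrableOn_of_contDiffAt hΩ_bdd fun x hx => by
      simp only [sq_abs]
      exact (hsol.smooth_η.slice ht hx).mul (ContDiffAt.sum fun i _ => ContDiffAt.sum fun j _ =>
        ((hvel i i x hx).sub (hvel j j x hx)).pow 2)
  have i3 : IntegrableOn
      (fun x => P.M (c t x) * ‖gradient (muTilde P (μbar t) (pbar t)) x‖ ^ 2) Ω :=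
    integrableOn_of_contDiffAt hΩ_bdd fun x hx => by
      simp only [norm_gradient_sq]
      exact (hsol.smooth_M.slice ht hx).mul
        (ContDiffAt.sum fun i _ => (contDiffAt_pd (hm x hx) i).pow 2)
  have iQ : ∀ i, IntegrableOn (fun x => pd i (Q i) x) Ω := fun i =>
    integrableOn_of_contDiffAt hΩ_bdd fun x hx => contDiffAt_pd (hQsmooth i x hx) i
  have ikin : IntegrableOn (fun x => deriv (fun s => P.ρ (c s x) * ‖u s x‖ ^ 2 / 2) t) Ω :=
    integrableOn_of_contDiffAt hΩ_bdd fun x hx => hkin.timeDeriv.slice ht hx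
  have imix : IntegrableOn
      (fun x => deriv (fun s => P.ρ (c s x) * mixingEnergy P (c s) x) t) Ω :=
    integrableOn_of_contDiffAt hΩ_bdd fun x hx => hmix.timeDeriv.slice ht hx
  have i12 : IntegrableOn (fun x => 1 / P.Re * (P.η (c t x) * ∑ i : Fin 3, ∑ j ∈ Finset.Ioi i,
        |velGrad₃ (u t) x i j + velGrad₃ (u t) x j i| ^ 2)
      + 2 / (3 * P.Re) * (P.η (c t x) * ∑ i : Fin 3, ∑ j ∈ Finset.Ioi i,
        |velGrad₃ (u t) x i i - velGrad₃ (u t) x j j| ^ 2)) Ω :=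
    (i1.const_mul _).add (i2.const_mul _)
  -- the bulk: integrate the local energy balance
  have hbulk : (∫ x in Ω, deriv (fun s => P.ρ (c s x) * ‖u s x‖ ^ 2 / 2) t)
      + 1 / P.β * (∫ x in Ω, deriv (fun s => P.ρ (c s x) * mixingEnergy P (c s) x) t) =
      ∑ i, (∫ x in Ω, pd i (Q i) x)
      - (1 / P.Re * (∫ x in Ω, P.η (c t x) * ∑ i : Fin 3, ∑ j ∈ Finset.Ioi i,
            |velGrad₃ (u t) x i j + velGrad₃ (u t) x j i| ^ 2)
        + 2 / (3 * P.Re) * (∫ x in Ω, P.η (c t x) * ∑ i : Fin 3, ∑ j ∈ Finset.Ioi i,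
            |velGrad₃ (u t) x i i - velGrad₃ (u t) x j j| ^ 2)
        + 1 / P.β *
          (∫ x in Ω, P.M (c t x) * ‖gradient (muTilde P (μbar t) (pbar t)) x‖ ^ 2)) := by
    rw [← integral_const_mul, ← integral_const_mul, ← integral_const_mul, ← integral_const_mul,
      ← integral_finsetSum _ fun i _ => iQ i, ← integral_add ikin (imix.const_mul _),
      ← integral_add (i1.const_mul _) (i2.const_mul _),
      ← integral_add i12 (i3.const_mul _),
      ← integral_sub (integrable_finsetSum _ fun i _ => iQ i)
        (Integrable.fun_add i12 (i3.const_mul _))]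
    exact setIntegral_congr_fun hΩ_open.measurableSet fun x hx =>
      hsol.local_energy_balance ht hd hx
  -- the wall: the flux through the boundary is the dissipation on the wall
  have hgauss : ∀ i, ∫ x in Ω, pd i (Q i) x =
      ∫ x, Q i x * inner ℝ (outerNormal Ω x) (EuclideanSpace.single i 1) ∂surfaceMeasure Ω :=
    fun i => integral_fderiv_eq_surfaceIntegral hΩ_open hΩ_bdd hΩ_lip
      (fun x hx => (hQsmooth i x hx).of_le (by simp)) _
  have iS : ∀ i, Integrable
      (fun x => Q i x * inner ℝ (outerNormal Ω x) (EuclideanSpace.single i 1))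
      (surfaceMeasure Ω) := fun i =>
    integrable_surfaceMeasure_mul_inner hΩ_lip hΩ_bdd (fun x hx =>
      (hQsmooth i x (frontier_subset_closure hx)).continuousAt.continuousWithinAt) _
  have ifw : Integrable (fun x => deriv (fun s => P.fw (c s x)) t) (surfaceMeasure Ω) := by
    have hcont : ContinuousOn (fun x => deriv (fun s => P.fw (c s x)) t) (closure Ω) :=
      fun x hx => (hfw.timeDeriv.slice ht hx).continuousAt.continuousWithinAt
    obtain ⟨C, hC⟩ := hcl.exists_bound_of_continuousOn hcont
    refine Integrable.of_bound
      (aestronglyMeasurable_surfaceMeasure (hcont.mono frontier_subset_closure)) C ?_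
    filter_upwards [hSae] with x hx using hC x hx
  have hwall : ∑ i, (∫ x in Ω, pd i (Q i) x)
      + P.αw / P.β * (∫ x, deriv (fun s => P.fw (c s x)) t ∂surfaceMeasure Ω) =
      -∫ x, (1 / P.β * P.MΓ (c t x) * |wallPotential P (c t) x (outerNormal Ω x)| ^ 2
            + 1 / (P.ls (c t x) * P.Re) * ‖tangential (outerNormal Ω x) (u t x)‖ ^ 2)
          ∂surfaceMeasure Ω := by
    rw [Finset.sum_congr rfl fun i _ => hgauss i, ← integral_finsetSum _ fun i _ => iS i,
      ← integral_const_mul, ← integral_add (integrable_finsetSum _ fun i _ => iS i)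
        (ifw.const_mul _), ← integral_neg]
    refine integral_congr_ae ?_
    filter_upwards [ae_mem_frontier, ae_isOuterUnitNormal hΩ_lip hΩ_bdd] with x hx hn
    rw [← hsol.wall_energy_balance ht hx hn]
    congr 1
    refine Finset.sum_congr rfl fun i _ => ?_
    rw [EuclideanSpace.inner_single_right]
    simp [hQ]
  linear_combination hbulk + hwall
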